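/- **Notation.** $U$ is the hyperbolic plane (Gram matrix $\begin{pmatrix}0&1\\1&0\end{pmatrix}$), $U(2)$ is $U$ with its form multiplied by $2$, $E_8(-1)$ is the $E_8$ root lattice with its form negated, $\langle a\rangle$ is the rank one lattice generated by a vector of square $a$, and $\oplus$ is the orthogonal direct sum. For integers $m\ge 0$ and $d\ge 1$ put $$II_{2,8m+2}=2U\oplus mE_8(-1),\quad L_{2d}^{(m)}=2U\oplus mE_8(-1)\oplus\langle -2d\rangle,\quad K_{II}^{(m)}=U\oplus mE_8(-1)\oplus\langle 2\rangle,$$ $$K_{2d}^{(m)}=U\oplus mE_8(-1)\oplus\langle 2\rangle\oplus\langle -2d\rangle,\qquad T_{2,8m+2}=U\oplus U(2)\oplus mE_8(-1),$$ and, for $d\equiv 1\bmod 4$, $$N_{2d}^{(m)}=U\oplus mE_8(-1)\oplus\begin{pmatrix}2&1\\1&\frac{1-d}{2}\end{pmatrix}.$$ For an even lattice $L$ of signature $(2,n)$, $n\ge 1$, with form $(\,,\,)$, $\mathrm O(L)$ is its orthogonal group; $\mathrm O^+(L)\subset\mathrm O(L)$ is the subgroup preserving each of the two connected components of $\{[w]\in\mathbb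 P(L\otimes\mathbb C)\mid (w,w)=0,\ (w,\bar w)>0\}$; $\widetilde{\mathrm O}(L)\subset\mathrm O(L)$ is the subgroup acting trivially on $L^\vee/L$, where $L^\vee$ is the dual lattice; and $\widetilde{\mathrm O}^+(L)=\widetilde{\mathrm O}(L)\cap\mathrm O^+(L)$. A $(k)$-vector is a primitive vector $r\in L$ with $(r,r)=k$. The divisor $\mathrm{div}(r)$ of $r\neq 0$ is the positive generator of the ideal $(r,L)\subset\mathbb Z$. Orthogonal complements are taken in the lattice containing $r$, and $\rho(d)$ is the number of distinct prime divisors of $d$. **Proposition.** Let $m\ge 0$ and $d\ge 1$ be integers. * (i) The $(-2)$-vectors of $II_{2,8m+2}$ form exactly one $\mathrm O^+(II_{2,8m+2})$-orbit, and the orthogonal complement of each of them is isometric to $K_{II}^{(m)}$. * (ii) Every $(-2)$-vector $r$ of $L_{2d}^{(m)}$ has $\mathrm{div}(r)\in\{1,2\}$. Those with $\mathrm{div}(r)=1$ form exactly one $\widetilde{\mathrm O}^+(L_{2d}^{(m)})$-orbit. If $d\equiv 1\bmod 4$, those with $\mathrm{div}(r)=2$ form exactly one $\widetilde{\mathrm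 O}^+(L_{2d}^{(m)})$-orbit; if $d\not\equiv 1\bmod 4$, there are none with $\mathrm{div}(r)=2$. The orthogonal complement of $r$ is isometric to $K_{2d}^{(m)}$ if $\mathrm{div}(r)=1$, and to $N_{2d}^{(m)}$ if $\mathrm{div}(r)=2$. * (iii) Let $r$ be a $(-2d)$-vector of $L_{2d}^{(m)}$. If $\mathrm{div}(r)=2d$, its orthogonal complement is isometric to $II_{2,8m+2}$. If $\mathrm{div}(r)=d$, its orthogonal complement is isometric to $K_2^{(m)}=U\oplus mE_8(-1)\oplus\langle 2\rangle\oplus\langle -2\rangle$ or to $T_{2,8m+2}$. * (iv) Suppose $d>1$. The number of $\widetilde{\mathrm O}(L_{2d}^{(m)})$-orbits of $(-2d)$-vectors $r$ with $\mathrm{div}(r)=2d$ is $2^{\rho(d)}$. The number of $\widetilde{\mathrm O}(L_{2d}^{(m)})$-orbits of $(-2d)$-vectors $r$ with $\mathrm{div}(r)=d$ is $$\begin{cases}2^{\rho(d)}&\text{if } d \text{ is odd or } d\equiv 4\bmod 8,\\ 2^{\rho(d)+1}&\text{if } d\equiv 0\bmod 8,\\ 2^{\rho(d)-1}&\text{if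 } d\equiv 2\bmod 4.\end{cases}$$ -/

import Mathlib

namespace LatticeOrbits

open Matrix

noncomputable section

/-! ### Lattices

A lattice is `ι → ℤ` with the bilinear form given by an integral Gram matrix
`S : Matrix ι ι ℤ` (symmetric for every lattice that occurs below). -/

section General

variable {ι : Type} [Fintype ι] [DecidableEq ι]

/-- The bilinear form `(x, y) = xᵀ S y` on the lattice `L = ι → ℤ` with Gram matrix `S`. -/
def form (S : Matrix ι ι ℤ) : LinearMap.BilinForm ℤ (ι → ℤ) := Matrix.toBilin' S

/-- The `R`-bilinear extension of the form to `L ⊗ R = ι → R`. -/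
def formOver (R : Type) [CommRing R] (S : Matrix ι ι ℤ) : LinearMap.BilinForm R (ι → R) :=
  Matrix.toBilin' (S.map (Int.castRingHom R))

/-- The `R`-linear extension to `L ⊗ R` of an automorphism of the abelian group `L`. -/
def extend (R : Type) [CommRing R] (g : (ι → ℤ) ≃ₗ[ℤ] (ι → ℤ)) : (ι → R) →ₗ[R] (ι → R) :=
  Matrix.toLin' ((LinearMap.toMatrix' (g : (ι → ℤ) →ₗ[ℤ] (ι → ℤ))).map (Int.castRingHom R))

/-- The inclusion `L → L ⊗ ℚ`. -/
def toRat (l : ι → ℤ) : ι → ℚ := fun i => (l i : ℚ)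

theorem extend_one (R : Type) [CommRing R] (x : ι → R) :
    extend R (1 : (ι → ℤ) ≃ₗ[ℤ] (ι → ℤ)) x = x := by
  have h : LinearMap.toMatrix' (((1 : (ι → ℤ) ≃ₗ[ℤ] (ι → ℤ)) : (ι → ℤ) →ₗ[ℤ] (ι → ℤ)))
      = (1 : Matrix ι ι ℤ) := LinearMap.toMatrix'_id
  rw [extend, h]
  simp

theorem extend_mul (R : Type) [CommRing R] (g h : (ι → ℤ) ≃ₗ[ℤ] (ι → ℤ)) (x : ι → R) :
    extend R (g * h) x = extend R g (extend R h x) := by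
  have e : LinearMap.toMatrix' (((g * h : (ι → ℤ) ≃ₗ[ℤ] (ι → ℤ)) : (ι → ℤ) →ₗ[ℤ] (ι → ℤ)))
      = LinearMap.toMatrix' (g : (ι → ℤ) →ₗ[ℤ] (ι → ℤ)) *
        LinearMap.toMatrix' (h : (ι → ℤ) →ₗ[ℤ] (ι → ℤ)) := LinearMap.toMatrix'_comp _ _
  simp only [extend, e, Matrix.map_mul, Matrix.toLin'_mul, LinearMap.comp_apply]

theorem extend_toRat (g : (ι → ℤ) ≃ₗ[ℤ] (ι → ℤ)) (l : ι → ℤ) :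
    extend ℚ g (toRat l) = toRat (g l) := by
  have e : g l = (LinearMap.toMatrix' (g : (ι → ℤ) →ₗ[ℤ] (ι → ℤ))) *ᵥ l :=
    (LinearMap.toMatrix'_mulVec (g : (ι → ℤ) →ₗ[ℤ] (ι → ℤ)) l).symm
  funext i
  rw [toRat, e]
  simp [extend, toRat, Matrix.mulVec, dotProduct]

/-- The orthogonal group `O(L)`. -/
def orthogonalGroup (S : Matrix ι ι ℤ) : Subgroup ((ι → ℤ) ≃ₗ[ℤ] (ι → ℤ)) where
  carrier := {g | ∀ x y, form S (g x) (g y) = form S x y}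
  one_mem' := fun _ _ => rfl
  mul_mem' := fun {a b} ha hb x y => (ha (b x) (b y)).trans (hb x y)
  inv_mem' := fun {a} ha x y => by
    have h := ha (a⁻¹ x) (a⁻¹ y)
    have hx : ∀ z, a (a⁻¹ z) = z := fun z => a.apply_symm_apply z
    rw [hx, hx] at h
    exact h.symm

theorem formOver_extend (R : Type) [CommRing R] {S : Matrix ι ι ℤ}
    {g : (ι → ℤ) ≃ₗ[ℤ] (ι → ℤ)} (hg : g ∈ orthogonalGroup S) (x y : ι → R) :
    formOver R S (extend R g x) (extend R g y) = formOver R S x y := by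
  set A := LinearMap.toMatrix' (g : (ι → ℤ) →ₗ[ℤ] (ι → ℤ)) with hA
  have hS : Aᵀ * S * A = S := by
    have h1 : (form S).comp (g : (ι → ℤ) →ₗ[ℤ] (ι → ℤ)) (g : (ι → ℤ) →ₗ[ℤ] (ι → ℤ)) = form S := by
      refine LinearMap.ext fun x => LinearMap.ext fun y => ?_
      exact hg x y
    have h2 := congrArg (LinearMap.BilinForm.toMatrix') h1
    rw [LinearMap.BilinForm.toMatrix'_comp] at h2
    simpa [form] using h2
  have hS' : (A.map (Int.castRingHom R))ᵀ * S.map (Int.castRingHom R) *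
      A.map (Int.castRingHom R) = S.map (Int.castRingHom R) := by
    rw [← Matrix.transpose_map, ← Matrix.map_mul, ← Matrix.map_mul, hS]
  have h3 : (formOver R S).comp (extend R g) (extend R g) = formOver R S := by
    have h4 : extend R g = Matrix.toLin' (A.map (Int.castRingHom R)) := rfl
    rw [h4, formOver, Matrix.toBilin'_comp]
    simp only [hS']
  exact LinearMap.congr_fun (LinearMap.congr_fun h3 x) y

/-- Membership in the dual lattice `L^∨ = {v ∈ L ⊗ ℚ | (v, l) ∈ ℤ for all l ∈ L}`. -/
def InDual (S : Matrix ι ι ℤ) (v : ι → ℚ) : Prop :=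
  ∀ l : ι → ℤ, ∃ k : ℤ, formOver ℚ S v (toRat l) = k

theorem InDual.extend {S : Matrix ι ι ℤ} {g : (ι → ℤ) ≃ₗ[ℤ] (ι → ℤ)}
    (hg : g ∈ orthogonalGroup S) {v : ι → ℚ} (hv : InDual S v) :
    InDual S (extend ℚ g v) := fun l => by
  obtain ⟨k, hk⟩ := hv (g⁻¹ l)
  refine ⟨k, ?_⟩
  rw [← hk, ← formOver_extend ℚ hg v, extend_toRat]
  congr 2
  exact (g.apply_symm_apply l).symm

/-- The stable orthogonal group: the elements of `O(L)` that act trivially on the discriminant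
group `L^∨ / L`, i.e. `g v - v ∈ L` for all `v ∈ L^∨`. -/
def stableOrthogonalGroup (S : Matrix ι ι ℤ) : Subgroup ((ι → ℤ) ≃ₗ[ℤ] (ι → ℤ)) where
  carrier := {g | g ∈ orthogonalGroup S ∧
    ∀ v : ι → ℚ, InDual S v → ∃ l : ι → ℤ, extend ℚ g v - v = toRat l}
  one_mem' := ⟨one_mem _, fun v _ => ⟨0, by rw [extend_one]; funext i; simp [toRat]⟩⟩
  mul_mem' := fun {a b} ha hb => ⟨mul_mem ha.1 hb.1, fun v hv => by
    obtain ⟨l, hl⟩ := hb.2 v hv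
    obtain ⟨l', hl'⟩ := ha.2 _ (hv.extend hb.1)
    refine ⟨l' + l, ?_⟩
    have h : toRat (l' + l) = toRat l' + toRat l := by funext i; simp [toRat]
    rw [extend_mul, h, ← hl, ← hl']
    abel⟩
  inv_mem' := fun {a} ha => ⟨inv_mem ha.1, fun v hv => by
    obtain ⟨l, hl⟩ := ha.2 _ (hv.extend (inv_mem ha.1))
    refine ⟨-l, ?_⟩
    have h : toRat (-l) = -toRat l := by funext i; simp [toRat]
    rw [← extend_mul, mul_inv_cancel, extend_one] at hl
    rw [h, ← hl]
    abel⟩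

/-- The affine cone `{w ∈ L ⊗ ℂ | (w, w) = 0, (w, w̄) > 0}` over the (non-connected) type IV
domain of `L`; for `L` of signature `(2, n)` with `n ≥ 1` it has two connected components, the
affine cones over the two components of that domain. The number `(w, w̄)` is real. -/
def domainCone (S : Matrix ι ι ℤ) : Set (ι → ℂ) :=
  {w | formOver ℂ S w w = 0 ∧ 0 < (formOver ℂ S w (star w)).re}

theorem extend_star (g : (ι → ℤ) ≃ₗ[ℤ] (ι → ℤ)) (w : ι → ℂ) :
    extend ℂ g (star w) = star (extend ℂ g w) := by
  funext i
  simp [extend, Matrix.mulVec, dotProduct]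

theorem extend_mem_domainCone {S : Matrix ι ι ℤ} {g : (ι → ℤ) ≃ₗ[ℤ] (ι → ℤ)}
    (hg : g ∈ orthogonalGroup S) {w : ι → ℂ} (hw : w ∈ domainCone S) :
    extend ℂ g w ∈ domainCone S := by
  refine ⟨?_, ?_⟩
  · rw [formOver_extend ℂ hg]; exact hw.1
  · rw [← extend_star, formOver_extend ℂ hg]; exact hw.2

/-- `O⁺(L)`: the elements of `O(L)` that map each connected component of the type IV domain
(equivalently, of the cone over it) to itself. -/
def orthogonalGroupPlus (S : Matrix ι ι ℤ) : Subgroup ((ι → ℤ) ≃ₗ[ℤ] (ι → ℤ)) where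
  carrier := {g | g ∈ orthogonalGroup S ∧
    ∀ w ∈ domainCone S, extend ℂ g w ∈ connectedComponentIn (domainCone S) w}
  one_mem' := ⟨one_mem _, fun w hw => by rw [extend_one]; exact mem_connectedComponentIn hw⟩
  mul_mem' := fun {a b} ha hb => ⟨mul_mem ha.1 hb.1, fun w hw => by
    rw [extend_mul, connectedComponentIn_eq (hb.2 w hw)]
    exact ha.2 _ (extend_mem_domainCone hb.1 hw)⟩
  inv_mem' := fun {a} ha => ⟨inv_mem ha.1, fun w hw => by
    have hw' := extend_mem_domainCone (inv_mem ha.1) hw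
    have h := ha.2 _ hw'
    rw [← extend_mul, mul_inv_cancel, extend_one] at h
    rw [← connectedComponentIn_eq h]
    exact mem_connectedComponentIn hw'⟩

/-- The intersection of `O⁺(L)` with the stable orthogonal group. -/
def stableOrthogonalGroupPlus (S : Matrix ι ι ℤ) : Subgroup ((ι → ℤ) ≃ₗ[ℤ] (ι → ℤ)) :=
  orthogonalGroupPlus S ⊓ stableOrthogonalGroup S

/-- A vector is primitive if it is not a multiple of another lattice vector by a non-unit;
in particular it is nonzero. -/
def IsPrimitive (r : ι → ℤ) : Prop := ∀ (k : ℤ) (s : ι → ℤ), r = k • s → IsUnit k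

/-- A `(k)`-vector: a primitive vector `r` with `(r, r) = k`. -/
def IsKVector (S : Matrix ι ι ℤ) (k : ℤ) (r : ι → ℤ) : Prop :=
  IsPrimitive r ∧ form S r r = k

/-- The divisor `div(r)`: the non-negative generator of the ideal `(r, L)` of `ℤ`. -/
def divisor (S : Matrix ι ι ℤ) (r : ι → ℤ) : ℕ :=
  (Submodule.IsPrincipal.generator (LinearMap.range (form S r))).natAbs

theorem range_form_eq_span_divisor (S : Matrix ι ι ℤ) (r : ι → ℤ) :
    LinearMap.range (form S r) = Ideal.span {(divisor S r : ℤ)} := by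
  rw [divisor, Int.span_natAbs]
  exact (Ideal.span_singleton_generator (LinearMap.range (form S r))).symm

/-- The orthogonal complement of `r`, with the restricted form, is isometric to the lattice with
Gram matrix `T`. -/
def ComplementIsometric {κ : Type} [Fintype κ] [DecidableEq κ]
    (S : Matrix ι ι ℤ) (r : ι → ℤ) (T : Matrix κ κ ℤ) : Prop :=
  ((form S).restrict ((form S).orthogonal (Submodule.span ℤ {r}))).Equivalent (form T)

/-- The set of orbits of the group `G` on the lattice that meet the set `V`. -/
def orbits (G : Subgroup ((ι → ℤ) ≃ₗ[ℤ] (ι → ℤ))) (V : Set (ι → ℤ)) : Set (Set (ι → ℤ)) :=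
  (fun v => MulAction.orbit G v) '' V

end General

/-! ### The lattices of the statement -/

/-- Gram matrix of the orthogonal direct sum. -/
def orthSum {ι κ : Type} (S : Matrix ι ι ℤ) (T : Matrix κ κ ℤ) : Matrix (ι ⊕ κ) (ι ⊕ κ) ℤ :=
  Matrix.fromBlocks S 0 0 T

/-- The hyperbolic plane `U`. -/
def hypU : Matrix (Fin 2) (Fin 2) ℤ := !![0, 1; 1, 0]

/-- The rank one lattice `⟨a⟩`. -/
def rankOne (a : ℤ) : Matrix (Fin 1) (Fin 1) ℤ := !![a]

/-- `m E₈(-1)`: the orthogonal sum of `m` copies of the negative of the `E₈` root lattice. -/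
def mE8neg (m : ℕ) : Matrix (Fin 8 × Fin m) (Fin 8 × Fin m) ℤ :=
  Matrix.blockDiagonal fun _ : Fin m => -CartanMatrix.E₈

/-- `II_{2,8m+2} = 2U ⊕ m E₈(-1)`. -/
def latII (m : ℕ) := orthSum (orthSum hypU hypU) (mE8neg m)

/-- `L_{2d}^{(m)} = 2U ⊕ m E₈(-1) ⊕ ⟨-2d⟩`. -/
def latL (m d : ℕ) := orthSum (latII m) (rankOne (-2 * (d : ℤ)))

/-- `K_{II}^{(m)} = U ⊕ m E₈(-1) ⊕ ⟨2⟩`. -/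
def latKII (m : ℕ) := orthSum (orthSum hypU (mE8neg m)) (rankOne 2)

/-- `K_{2d}^{(m)} = U ⊕ m E₈(-1) ⊕ ⟨2⟩ ⊕ ⟨-2d⟩`. -/
def latK (m d : ℕ) := orthSum (latKII m) (rankOne (-2 * (d : ℤ)))

/-- `N_{2d}^{(m)}`: the sum of `U ⊕ m E₈(-1)` and the plane with Gram matrix
`(2, 1; 1, (1 - d) / 2)`. It is used only for `d ≡ 1 mod 4`, when the division is exact. -/
def latN (m d : ℕ) := orthSum (orthSum hypU (mE8neg m)) !![2, 1; 1, (1 - (d : ℤ)) / 2]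

/-- `T_{2,8m+2} = U ⊕ U(2) ⊕ m E₈(-1)`. -/
def latT (m : ℕ) := orthSum (orthSum hypU ((2 : ℤ) • hypU)) (mE8neg m)

/-- `ρ(d)`: the number of prime divisors of `d`. -/
def rho (d : ℕ) : ℕ := d.primeFactors.card

end

end LatticeOrbits

/-!
The whole statement rests on Eichler's criterion (`eichler_criterion`). In an even lattice with two
orthogonal hyperbolic planes `(e, f)` and `(e₁, f₁)`, two vectors of the same norm and the same
divisor `D` that are congruent modulo `D` lie in one orbit of any group of isometries that contains
the Eichler transvections and acts trivially on the discriminant group. The proof is a descent: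
where `(·, f)` takes its least positive value on the orbit of `v`, this value divides every product
with the vector (`dvd_form_of_minimal`), so it is `D`. Once both vectors have product `D` with `f`,
a single transvection along `f` carries one to the other. Integral transvections act trivially on
the discriminant group, and they preserve the components of the type IV domain because scaling
their parameter by a real number connects them to the identity (`eichlerEquiv_mem_plus`). Hence the
criterion holds for the stable `O⁺`.

In `L = II ⊕ ⟨-2d⟩`, with `h` a generator of the second summand, unimodularity of `II` shows that a
vector of divisor `D` is `D l + x h`. By the criterion its orbit is determined by its norm, `D` and
`x` modulo `D`, and it contains `D (e + b f) + x h` with the same `x` (`exists_stdVec`). The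
orthogonal complement of the latter is `U ⊕ m E₈(-1)` plus the binary lattice `(-2b, t; t, -2d)`
with `D t = 2 d x` (`complementIsometric_stdVec`). For norm `-2d` this is once or twice a binary
lattice of determinant `-1`, and such a lattice has a primitive isotropic vector, hence is `U` or
`⟨1⟩ ⊕ ⟨-1⟩`.

Equating norms turns the count of orbits of `(-2d)`-vectors into the count of `x` modulo `2d` with
`x² ≡ 1` modulo `4d`, for divisor `2d`, and of `x` modulo `d` with `x² ≡ 1` modulo `d`, for divisor
`d`. The former correspond to the idempotents `(x + 1) / 2` modulo `d`. Both counts are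
multiplicative, and are read off at prime powers.
-/

namespace LatticeOrbits

open Matrix

/-! ### Eichler transvections -/

section Transvection

variable {R V : Type*} [CommRing R] [AddCommGroup V] [Module R V]

/-- The Eichler transvection `x ↦ x + (u, x) a - (a, x) u - q (u, x) u`. It is meant for `u`
isotropic, `a` orthogonal to `u` and `(a, a) = 2 q`; the half-norm `q` is a separate argument so
that no division by `2` is needed. -/
def eichlerMap (B : LinearMap.BilinForm R V) (u a : V) (q : R) : V →ₗ[R] V :=
  LinearMap.id + (B u).smulRight a - (B a).smulRight u - (q • B u).smulRight u

theorem eichlerMap_apply (B : LinearMap.BilinForm R V) (u a : V) (q : R) (x : V) :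
    eichlerMap B u a q x = x + B u x • a - B a x • u - (q * B u x) • u := by
  simp [eichlerMap]

theorem form_eichlerMap {B : LinearMap.BilinForm R V} (hB : ∀ x y, B x y = B y x) {u a : V} {q : R}
    (hu : B u u = 0) (hua : B u a = 0) (ha : B a a = 2 * q) (x y : V) :
    B (eichlerMap B u a q x) (eichlerMap B u a q y) = B x y := by
  have hau : B a u = 0 := by rw [hB, hua]
  simp only [eichlerMap_apply, map_add, map_sub, map_smul, LinearMap.add_apply,
    LinearMap.sub_apply, LinearMap.smul_apply, smul_eq_mul, hu, hua, hau, ha, hB x u, hB x a]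
  ring

theorem eichlerMap_neg_eichlerMap {B : LinearMap.BilinForm R V} (hB : ∀ x y, B x y = B y x)
    {u a : V} {q : R} (hu : B u u = 0) (hua : B u a = 0) (ha : B a a = 2 * q) (x : V) :
    eichlerMap B u (-a) q (eichlerMap B u a q x) = x := by
  have hau : B a u = 0 := by rw [hB, hua]
  simp only [eichlerMap_apply, map_add, map_sub, map_smul, map_neg, LinearMap.neg_apply,
    hu, hua, hau, ha]
  module

/-- The Eichler transvection as a linear automorphism. -/
def eichlerEquiv {B : LinearMap.BilinForm R V} (hB : ∀ x y, B x y = B y x) {u a : V} {q : R}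
    (hu : B u u = 0) (hua : B u a = 0) (ha : B a a = 2 * q) : V ≃ₗ[R] V :=
  LinearEquiv.ofLinearMap (eichlerMap B u a q) (eichlerMap B u (-a) q)
    (LinearMap.ext fun x => by
      have h := eichlerMap_neg_eichlerMap hB hu (a := -a) (q := q) (by simp [hua]) (by simp [ha]) x
      simpa using h)
    (LinearMap.ext fun x => by
      have h := eichlerMap_neg_eichlerMap hB hu hua ha x
      simpa using h)

theorem eichlerEquiv_apply {B : LinearMap.BilinForm R V} (hB : ∀ x y, B x y = B y x) {u a : V}
    {q : R} (hu : B u u = 0) (hua : B u a = 0) (ha : B a a = 2 * q) (x : V) :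
    eichlerEquiv hB hu hua ha x = eichlerMap B u a q x := rfl

end Transvection

/-! ### The Eichler criterion -/

/-- A pair of orthogonal hyperbolic planes: `(e, f)` and `(e₁, f₁)` are hyperbolic pairs, orthogonal
to each other. -/
structure HyperbolicPairs {M : Type*} [AddCommGroup M] (B : LinearMap.BilinForm ℤ M)
    (e f e₁ f₁ : M) : Prop where
  ee : B e e = 0
  ff : B f f = 0
  ef : B e f = 1
  ee₁ : B e e₁ = 0
  ef₁ : B e f₁ = 0
  fe₁ : B f e₁ = 0
  ff₁ : B f f₁ = 0
  e₁e₁ : B e₁ e₁ = 0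
  f₁f₁ : B f₁ f₁ = 0
  e₁f₁ : B e₁ f₁ = 1

section Criterion

variable {M : Type*} [AddCommGroup M] {B : LinearMap.BilinForm ℤ M} {e f e₁ f₁ : M}
  {G : Subgroup (M ≃ₗ[ℤ] M)}

/-- The group `G` contains all Eichler transvections of the even lattice `(M, B)`. -/
def ContainsTransvections (B : LinearMap.BilinForm ℤ M) (G : Subgroup (M ≃ₗ[ℤ] M)) : Prop :=
  ∀ u a q, B u u = 0 → B u a = 0 → B a a = 2 * q → ∃ g ∈ G, ∀ x, g x = eichlerMap B u a q x

theorem exists_orthogonal_part (hB : ∀ x y, B x y = B y x) (H : HyperbolicPairs B e f e₁ f₁)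
    (x : M) : ∃ x₀, x = B x f • e + B x e • f + B x f₁ • e₁ + B x e₁ • f₁ + x₀ ∧
      B x₀ e = 0 ∧ B x₀ f = 0 ∧ B x₀ e₁ = 0 ∧ B x₀ f₁ = 0 := by
  refine ⟨x - (B x f • e + B x e • f + B x f₁ • e₁ + B x e₁ • f₁), by abel, ?_, ?_, ?_, ?_⟩ <;>
  simp [H.ee, H.ff, H.ef, H.ee₁, H.ef₁, H.fe₁, H.ff₁, H.e₁e₁, H.f₁f₁, H.e₁f₁, hB f e, hB f₁ e,
    hB e₁ e, hB f₁ f, hB e₁ f, hB f₁ e₁]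

/-- A common divisor of the products of `x` with the four hyperbolic vectors and with their
orthogonal complement divides all products with `x`. -/
theorem dvd_form_of_dvd (hB : ∀ x y, B x y = B y x) (H : HyperbolicPairs B e f e₁ f₁) {α : ℤ}
    {v : M} (he : α ∣ B v e) (hf : α ∣ B v f) (he₁ : α ∣ B v e₁) (hf₁ : α ∣ B v f₁)
    (h : ∀ a, B a e = 0 → B a f = 0 → B a e₁ = 0 → B a f₁ = 0 → α ∣ B v a) (y : M) :
    α ∣ B v y := by
  obtain ⟨a, hy, h1, h2, h3, h4⟩ := exists_orthogonal_part hB H y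
  rw [hy]
  simp only [map_add, map_smul, smul_eq_mul]
  exact dvd_add (dvd_add (dvd_add (dvd_add (he.mul_left _) (hf.mul_left _)) (he₁.mul_left _))
    (hf₁.mul_left _)) (h a h1 h2 h3 h4)

/-- The transvections by the multiples `k a` of an isotropic vector `a`. -/
theorem exists_eichlerMap_smul (hG : ContainsTransvections B G) {u a : M} (hu : B u u = 0)
    (hua : B u a = 0) (ha : B a a = 0) (k : ℤ) :
    ∃ g ∈ G, ∀ x, g x = x + (k * B u x) • a - (k * B a x) • u := by
  obtain ⟨g, hg, h⟩ := hG u (k • a) 0 hu (by simp [hua]) (by simp [ha])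
  refine ⟨g, hg, fun x => ?_⟩
  rw [h, eichlerMap_apply]
  simp [smul_smul, mul_comm]

/-- The orbit of a vector not orthogonal to the whole lattice contains a vector with `(·, f) > 0`.
If `(·, f)` is nowhere positive, moving by large multiples of transvections shows that its products
with the hyperbolic vectors, and then with all vectors, vanish. -/
theorem exists_form_pos (hB : ∀ x y, B x y = B y x) (heven : ∀ x, Even (B x x))
    (H : HyperbolicPairs B e f e₁ f₁) (hG : ContainsTransvections B G) {v y : M}
    (hy : B v y ≠ 0) : ∃ g ∈ G, 0 < B (g v) f := by
  by_contra! hcon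
  have hfe : B f e = 1 := by rw [hB, H.ef]
  -- the products with the hyperbolic vectors vanish on the whole orbit, one after the other
  have aux : ∀ a : M, B e a = 0 → B a a = 0 → B a f = 0 → ∀ g ∈ G, B (g v) a = 0 := by
    intro a h1 h2 h3 g hg
    by_contra h0
    obtain ⟨t, ht, h⟩ := exists_eichlerMap_smul hG H.ee h1 h2
      (B (g v) a * (B (g v) f - 1))
    have := hcon (t * g) (mul_mem ht hg)
    rw [LinearEquiv.mul_apply, h] at this
    simp only [map_add, map_sub, map_smul, LinearMap.add_apply, LinearMap.sub_apply,
      LinearMap.smul_apply, smul_eq_mul, h3, H.ef, hB a (g v)] at this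
    have hle := hcon g hg
    have := mul_self_pos.mpr h0
    nlinarith
  have h1 : ∀ g ∈ G, B (g v) e₁ = 0 := aux e₁ H.ee₁ H.e₁e₁ (by rw [hB, H.fe₁])
  have h2 : ∀ g ∈ G, B (g v) f₁ = 0 := aux f₁ H.ef₁ H.f₁f₁ (by rw [hB, H.ff₁])
  have h3 : ∀ g ∈ G, B (g v) f = 0 := by
    intro g hg
    obtain ⟨t, ht, h⟩ := exists_eichlerMap_smul hG H.ff H.ff₁ H.f₁f₁ 1
    have := h1 (t * g) (mul_mem ht hg)
    rw [LinearEquiv.mul_apply, h] at this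
    simpa [h1 g hg, H.fe₁, hB f₁ e₁, H.e₁f₁, hB f (g v)] using this
  have h4 : ∀ g ∈ G, B (g v) e = 0 := by
    intro g hg
    obtain ⟨t, ht, h⟩ := exists_eichlerMap_smul hG H.ee H.ee₁ H.e₁e₁ 1
    have := h2 (t * g) (mul_mem ht hg)
    rw [LinearEquiv.mul_apply, h] at this
    simpa [h2 g hg, H.ef₁, H.e₁f₁, hB e (g v)] using this
  refine hy (zero_dvd_iff.mp (dvd_form_of_dvd hB H ?_ ?_ ?_ ?_ ?_ y))
  · exact (h4 1 (one_mem _)).symm ▸ dvd_rfl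
  · exact (h3 1 (one_mem _)).symm ▸ dvd_rfl
  · exact (h1 1 (one_mem _)).symm ▸ dvd_rfl
  · exact (h2 1 (one_mem _)).symm ▸ dvd_rfl
  · intro a _ _ ha1 ha2
    obtain ⟨q, hq⟩ := heven a
    obtain ⟨t, ht, h⟩ := hG e₁ a q H.e₁e₁ (by rw [hB, ha1]) (by rw [hq]; ring)
    have := h2 t ht
    have h10 : B e₁ v = 0 := by rw [hB]; exact h1 1 (one_mem _)
    have h20 : B v f₁ = 0 := h2 1 (one_mem _)
    rw [h, eichlerMap_apply] at this
    simp [h10, h20, H.e₁f₁] at this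
    rw [hB, this]

/-- In the orbit of `v` the least positive value of `(·, f)` divides all products with the vector
where it is attained: otherwise a Euclidean division step, made by a transvection, lowers it. -/
theorem dvd_form_of_minimal (hB : ∀ x y, B x y = B y x) (heven : ∀ x, Even (B x x))
    (H : HyperbolicPairs B e f e₁ f₁) (hG : ContainsTransvections B G) {v : M}
    (hpos : 0 < B v f) (hmin : ∀ g ∈ G, 0 < B (g v) f → B v f ≤ B (g v) f) (y : M) :
    B v f ∣ B v y := by
  set α := B v f with hα
  have hfe : B f e = 1 := by rw [hB, H.ef]
  -- for `a` one of `e₁`, `f₁` and `a'` the other: transvections reduce `(g v, a)` modulo `α` and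
  -- then subtract the remainder from `(g v, f) = α`
  have step : ∀ a a' : M, B e a = 0 → B f a = 0 → B a a = 0 → B f a' = 0 → B a' a' = 0 →
      B a a' = 1 → ∀ g ∈ G, B (g v) f = α → α ∣ B (g v) a := by
    intro a a' hea hfa haa hfa' ha'a' haa' g hg hgα
    obtain ⟨s, hs, hs'⟩ := exists_eichlerMap_smul hG H.ff hfa' ha'a' (-(B (g v) a / α))
    obtain ⟨t, ht, ht'⟩ := exists_eichlerMap_smul hG H.ee hea haa 1
    have h1 : B (s (g v)) f = α := by
      rw [hs']; simp [hgα, H.ff, hB a' f, hfa']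
    have h2 : B (s (g v)) a = B (g v) a % α := by
      rw [hs']
      simp only [map_add, map_sub, map_smul, LinearMap.add_apply, LinearMap.sub_apply,
        LinearMap.smul_apply, smul_eq_mul, hB a' a, haa', hfa, hB f (g v), hgα]
      have := Int.mul_ediv_add_emod (B (g v) a) α
      linarith
    have h3 : B (t (s (g v))) f = α - B (g v) a % α := by
      rw [ht']
      simp [h1, hB a f, hfa, H.ef, hB a (s (g v)), h2]
    have h4 := Int.emod_lt_of_pos (B (g v) a) hpos
    have h5 := Int.emod_nonneg (B (g v) a) hpos.ne'
    have h6 := hmin (t * (s * g)) (mul_mem ht (mul_mem hs hg))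
    simp only [LinearEquiv.mul_apply, h3] at h6
    exact Int.dvd_of_emod_eq_zero (by linarith [h6 (by linarith)])
  have c1 : ∀ g ∈ G, B (g v) f = α → α ∣ B (g v) e₁ :=
    step e₁ f₁ H.ee₁ H.fe₁ H.e₁e₁ H.ff₁ H.f₁f₁ H.e₁f₁
  have c2 : ∀ g ∈ G, B (g v) f = α → α ∣ B (g v) f₁ :=
    step f₁ e₁ H.ef₁ H.ff₁ H.f₁f₁ H.fe₁ H.e₁e₁ (by rw [hB, H.e₁f₁])
  -- make the product with `e₁` vanish
  obtain ⟨k, hk⟩ : α ∣ B v e₁ := c1 1 (one_mem _) rfl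
  obtain ⟨l, hl⟩ : α ∣ B v f₁ := c2 1 (one_mem _) rfl
  obtain ⟨s, hs, hs'⟩ := exists_eichlerMap_smul hG H.ff H.ff₁ H.f₁f₁ (-k)
  have s1 : B (s v) f = α := by rw [hs']; simp [H.ff, hB f₁ f, H.ff₁, hα]
  have s2 : B (s v) e₁ = 0 := by
    rw [hs']; simp [H.fe₁, hB f₁ e₁, H.e₁f₁, hk, hB f v, ← hα, mul_comm]
  have s3 : B (s v) f₁ = α * l := by rw [hs']; simp [H.ff₁, H.f₁f₁, hl]
  have s4 : B (s v) e = B v e + k * (α * l) := by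
    rw [hs']; simp [hfe, hB f₁ e, H.ef₁, hB f₁ v, hl]
  refine dvd_form_of_dvd hB H ?_ dvd_rfl ⟨k, hk⟩ ⟨l, hl⟩ ?_ y
  · obtain ⟨t, ht, ht'⟩ := exists_eichlerMap_smul hG H.ee H.ee₁ H.e₁e₁ 1
    have t1 : B (t (s v)) f = α := by
      rw [ht']; simp [hB e₁ f, H.fe₁, hB e₁ (s v), s1, s2]
    have t2 := c2 (t * s) (mul_mem ht hs) t1
    rw [LinearEquiv.mul_apply, ht'] at t2
    simp only [map_add, map_sub, map_smul, LinearMap.add_apply, LinearMap.sub_apply,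
      LinearMap.smul_apply, smul_eq_mul, H.ef₁, H.e₁f₁, s3, hB e (s v), s4] at t2
    refine (Int.dvd_iff_dvd_of_dvd_sub (a := α) ?_).mp t2
    exact ⟨l + k * l, by ring⟩
  · intro a ha ha' ha1 ha2
    obtain ⟨q, hq⟩ := heven a
    obtain ⟨t, ht, ht'⟩ := hG e₁ a q H.e₁e₁ (by rw [hB, ha1]) (by rw [hq]; ring)
    have s5 : B (s v) a = B v a := by
      rw [hs']; simp [hB f a, ha', hB f₁ a, ha2]
    have t0 : t (s v) = s v - B v a • e₁ := by
      rw [ht', eichlerMap_apply, hB e₁ (s v), s2, hB a (s v), s5]; simp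
    have t1 : B (t (s v)) f = α := by rw [t0]; simp [s1, hB e₁ f, H.fe₁]
    have t2 := c2 (t * s) (mul_mem ht hs) t1
    rw [LinearEquiv.mul_apply, t0] at t2
    simp only [map_sub, map_smul, LinearMap.sub_apply, LinearMap.smul_apply, smul_eq_mul, s3,
      H.e₁f₁, mul_one] at t2
    exact (dvd_sub_right (dvd_mul_right _ _)).mp t2

/-- The orbit of a vector whose products generate the ideal `(D)` contains a vector with
`(v, f) = D`. -/
theorem exists_form_eq (hB : ∀ x y, B x y = B y x) (heven : ∀ x, Even (B x x))
    (H : HyperbolicPairs B e f e₁ f₁) (hG : ContainsTransvections B G)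
    (hiso : ∀ g ∈ G, ∀ x y, B (g x) (g y) = B x y) {D : ℕ} (hD : 0 < D) {v y : M}
    (hdvd : ∀ z, (D : ℤ) ∣ B v z) (hy : B v y = D) : ∃ g ∈ G, B (g v) f = D := by
  have hex : ∃ n : ℕ, 0 < n ∧ ∃ g ∈ G, B (g v) f = n := by
    obtain ⟨g, hg, h⟩ := exists_form_pos hB heven H hG (v := v) (y := y) (by rw [hy]; positivity)
    exact ⟨(B (g v) f).toNat, by omega, g, hg, by omega⟩
  classical
  obtain ⟨hpos, g, hg, h⟩ := Nat.find_spec hex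
  refine ⟨g, hg, ?_⟩
  have hinv : ∀ x z, B (g x) z = B x (g⁻¹ z) := fun x z => by
    rw [← hiso g hg x (g⁻¹ z)]
    exact congrArg _ (g.apply_symm_apply z).symm
  have h1 : B (g v) f ∣ B (g v) (g y) := by
    refine dvd_form_of_minimal hB heven H hG (by rw [h]; exact_mod_cast hpos) ?_ _
    intro g' hg' hp
    have := Nat.find_min' hex (m := (B (g' (g v)) f).toNat)
      ⟨by omega, g' * g, mul_mem hg' hg, by rw [LinearEquiv.mul_apply]; omega⟩
    omega
  rw [hiso g hg, hy] at h1
  have h2 : (D : ℤ) ∣ B (g v) f := by rw [hinv]; exact hdvd _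
  exact Int.dvd_antisymm (by rw [h]; positivity) (by positivity) h1 h2

/-- **Eichler's criterion.** In an even lattice with two orthogonal hyperbolic planes, two vectors
with the same norm and the same divisor `D` that are congruent modulo `D` lie in the same orbit of
any group `G` of isometries that contains the Eichler transvections and acts trivially on the
discriminant group. -/
theorem eichler_criterion (hB : ∀ x y, B x y = B y x) (heven : ∀ x, Even (B x x))
    (H : HyperbolicPairs B e f e₁ f₁) (hG : ContainsTransvections B G)
    (hiso : ∀ g ∈ G, ∀ x y, B (g x) (g y) = B x y) {D : ℕ} (hD : 0 < D)
    (hstab : ∀ g ∈ G, ∀ x, (∀ z, (D : ℤ) ∣ B x z) → ∃ l, g x = x + (D : ℤ) • l)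
    {v w y z : M}
    (hv : ∀ z, (D : ℤ) ∣ B v z) (hvy : B v y = D) (hw : ∀ z, (D : ℤ) ∣ B w z) (hwz : B w z = D)
    (hnorm : B v v = B w w) (hvw : ∃ l, w = v + (D : ℤ) • l) : ∃ g ∈ G, g v = w := by
  obtain ⟨g, hg, h⟩ := exists_form_eq hB heven H hG hiso hD hv hvy
  obtain ⟨g', hg', h'⟩ := exists_form_eq hB heven H hG hiso hD hw hwz
  obtain ⟨l, hl⟩ := hvw
  obtain ⟨l₁, hl₁⟩ := hstab g hg v hv
  obtain ⟨l₂, hl₂⟩ := hstab g' hg' w hw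
  have ha : g' w = g v + (D : ℤ) • (l + l₂ - l₁) := by
    rw [hl₁, hl₂, hl]; module
  set a := l + l₂ - l₁
  have haf : B a f = 0 := by
    have := congrArg (fun x => B x f) ha
    simpa [h, h', hD.ne'] using this
  have hfa : B f a = 0 := by rw [hB, haf]
  obtain ⟨q, hq⟩ := heven a
  obtain ⟨t, ht, ht'⟩ := hG f a q H.ff hfa (by rw [hq]; ring)
  -- the transvection along `f` reaches `g' w` up to a multiple of `f`; the norm shows it is zero
  have key : t (g v) = g' w - (B a (g v) + q * D) • f := by
    rw [ht', eichlerMap_apply, ha, hB f (g v), h]; module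
  have hk : B a (g v) + q * D = 0 := by
    have h1 : B (t (g v)) (t (g v)) = B w w := by rw [hiso t ht, hiso g hg, hnorm]
    rw [key] at h1
    simp only [map_sub, map_smul, LinearMap.sub_apply, LinearMap.smul_apply, smul_eq_mul,
      hiso g' hg', H.ff, h', hB f (g' w)] at h1
    have h2 : (B a (g v) + q * D) * ((D : ℤ) * 2) = 0 := by linarith
    simpa [hD.ne'] using h2
  refine ⟨g'⁻¹ * (t * g), mul_mem (inv_mem hg') (mul_mem ht hg), ?_⟩
  rw [LinearEquiv.mul_apply, LinearEquiv.mul_apply, key, hk, zero_smul, sub_zero]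
  exact g'.symm_apply_apply w

end Criterion

/-! ### Transvections of a Gram matrix -/

section Gram

variable {ι : Type} [Fintype ι] [DecidableEq ι]

/-- The inclusion `L → L ⊗ R`. -/
def castVec (R : Type) [CommRing R] (l : ι → ℤ) : ι → R := fun i => (l i : R)

theorem formOver_castVec (R : Type) [CommRing R] (S : Matrix ι ι ℤ) (x y : ι → ℤ) :
    formOver R S (castVec R x) (castVec R y) = (form S x y : R) := by
  simp [formOver, form, Matrix.toBilin'_apply, castVec]

theorem form_comm {S : Matrix ι ι ℤ} (hS : S.IsSymm) (x y : ι → ℤ) :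
    form S x y = form S y x := by
  simp only [form, Matrix.toBilin'_apply']
  rw [Matrix.dotProduct_mulVec, dotProduct_comm, ← Matrix.mulVec_transpose, hS.eq]

theorem formOver_comm (R : Type) [CommRing R] {S : Matrix ι ι ℤ} (hS : S.IsSymm) (x y : ι → R) :
    formOver R S x y = formOver R S y x := by
  simp only [formOver, Matrix.toBilin'_apply']
  rw [Matrix.dotProduct_mulVec, dotProduct_comm, ← Matrix.mulVec_transpose, ← Matrix.transpose_map,
    hS.eq]

theorem extend_castVec (R : Type) [CommRing R] (g : (ι → ℤ) ≃ₗ[ℤ] (ι → ℤ)) (l : ι → ℤ) :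
    extend R g (castVec R l) = castVec R (g l) := by
  have e : g l = (LinearMap.toMatrix' (g : (ι → ℤ) →ₗ[ℤ] (ι → ℤ))) *ᵥ l :=
    (LinearMap.toMatrix'_mulVec (g : (ι → ℤ) →ₗ[ℤ] (ι → ℤ)) l).symm
  funext i
  rw [castVec, e]
  simp [extend, castVec, Matrix.mulVec, dotProduct]

/-- A linear endomorphism of `L ⊗ R` that agrees with `g` on `L` is the extension of `g`. -/
theorem extend_eq_of_castVec {R : Type} [CommRing R] {g : (ι → ℤ) ≃ₗ[ℤ] (ι → ℤ)}
    {φ : (ι → R) →ₗ[R] (ι → R)} (h : ∀ l, φ (castVec R l) = castVec R (g l)) :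
    extend R g = φ := by
  refine LinearMap.pi_ext' fun i => LinearMap.ext_ring ?_
  have hi : castVec R (Pi.single i (1 : ℤ)) = Pi.single i (1 : R) := by
    funext j
    by_cases hj : j = i
    · subst hj; simp [castVec]
    · simp [castVec, hj]
  simp only [LinearMap.comp_apply, LinearMap.single_apply]
  rw [← hi, extend_castVec, h]

theorem extend_eichlerEquiv (R : Type) [CommRing R] {S : Matrix ι ι ℤ}
    (hS : ∀ x y, form S x y = form S y x) {u a : ι → ℤ} {q : ℤ} (hu : form S u u = 0)
    (hua : form S u a = 0) (ha : form S a a = 2 * q) :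
    extend R (eichlerEquiv hS hu hua ha) =
      eichlerMap (formOver R S) (castVec R u) (castVec R a) (q : R) := by
  refine extend_eq_of_castVec fun l => ?_
  rw [eichlerEquiv_apply, eichlerMap_apply, eichlerMap_apply]
  simp only [formOver_castVec]
  funext i
  simp [castVec]

/-- Eichler transvections act trivially on the discriminant group. -/
theorem eichlerEquiv_mem_stable {S : Matrix ι ι ℤ} (hsymm : S.IsSymm) {u a : ι → ℤ} {q : ℤ}
    (hu : form S u u = 0) (hua : form S u a = 0) (ha : form S a a = 2 * q) :
    eichlerEquiv (form_comm hsymm) hu hua ha ∈ stableOrthogonalGroup S := by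
  refine ⟨form_eichlerMap (form_comm hsymm) hu hua ha, fun v hv => ?_⟩
  obtain ⟨k, hk⟩ := hv u
  obtain ⟨n, hn⟩ := hv a
  refine ⟨k • a - n • u - (q * k) • u, ?_⟩
  rw [formOver_comm ℚ hsymm] at hk hn
  rw [extend_eichlerEquiv, eichlerMap_apply]
  change formOver ℚ S (castVec ℚ u) v = k at hk
  change formOver ℚ S (castVec ℚ a) v = n at hn
  rw [hk, hn]
  funext i
  simp [castVec, toRat]
  ring

/-- Eichler transvections preserve the components of the type IV domain: the transvections by the
real multiples `s a`, `s ∈ ℝ`, connect the given one to the identity. -/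
theorem eichlerEquiv_mem_plus {S : Matrix ι ι ℤ} (hsymm : S.IsSymm) {u a : ι → ℤ} {q : ℤ}
    (hu : form S u u = 0) (hua : form S u a = 0) (ha : form S a a = 2 * q) :
    eichlerEquiv (form_comm hsymm) hu hua ha ∈ orthogonalGroupPlus S := by
  refine ⟨form_eichlerMap (form_comm hsymm) hu hua ha, fun w hw => ?_⟩
  set U := castVec ℂ u
  set A := castVec ℂ a
  have hB := formOver_comm ℂ hsymm
  have hU : formOver ℂ S U U = 0 := by rw [formOver_castVec, hu]; simp
  have hUA : formOver ℂ S U A = 0 := by rw [formOver_castVec, hua]; simp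
  have hA : formOver ℂ S A A = 2 * (q : ℂ) := by rw [formOver_castVec, ha]; simp
  have hstar : ∀ (l : ι → ℤ) (x : ι → ℂ),
      formOver ℂ S (castVec ℂ l) (star x) = star (formOver ℂ S (castVec ℂ l) x) := fun l x => by
    simp [formOver, Matrix.toBilin'_apply, castVec]
  let γ : ℝ → (ι → ℂ) := fun s =>
    eichlerMap (formOver ℂ S) U ((s : ℂ) • A) ((s : ℂ) ^ 2 * q) w
  have hpres : ∀ (s : ℝ) (x y : ι → ℂ),
      formOver ℂ S (eichlerMap (formOver ℂ S) U ((s : ℂ) • A) ((s : ℂ) ^ 2 * q) x)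
        (eichlerMap (formOver ℂ S) U ((s : ℂ) • A) ((s : ℂ) ^ 2 * q) y) = formOver ℂ S x y :=
    fun s => form_eichlerMap hB hU (by simp [hUA]) (by simp [hA]; ring)
  have hγstar : ∀ s, star (γ s) =
      eichlerMap (formOver ℂ S) U ((s : ℂ) • A) ((s : ℂ) ^ 2 * q) (star w) := fun s => by
    simp only [γ, eichlerMap_apply, map_smul, LinearMap.smul_apply, smul_eq_mul]
    rw [hstar u w, hstar a w]
    funext i
    simp [U, A, castVec]
  have hmem : ∀ s, γ s ∈ domainCone S := fun s =>
    ⟨(hpres s w w).trans hw.1, by rw [hγstar]; exact hw.2.trans_eq (congrArg _ (hpres s w _).symm)⟩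
  have hcont : Continuous γ := by
    simp only [γ, eichlerMap_apply, map_smul, LinearMap.smul_apply]
    fun_prop
  have h0 : γ 0 = w := by simp [γ, eichlerMap_apply]
  have h1 : γ 1 = extend ℂ (eichlerEquiv (form_comm hsymm) hu hua ha) w := by
    rw [extend_eichlerEquiv]; simp [γ, U, A]
  have hsub := (isPreconnected_range hcont).subset_connectedComponentIn ⟨0, h0⟩
    (Set.range_subset_iff.mpr hmem)
  exact hsub ⟨1, h1⟩

theorem containsTransvections {S : Matrix ι ι ℤ} (hsymm : S.IsSymm) :
    ContainsTransvections (form S) (stableOrthogonalGroupPlus S) := fun _ _ _ hu hua ha =>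
  ⟨eichlerEquiv (form_comm hsymm) hu hua ha,
    ⟨eichlerEquiv_mem_plus hsymm hu hua ha, eichlerEquiv_mem_stable hsymm hu hua ha⟩,
    fun _ => rfl⟩

/-- If all products with `x` are divisible by `D`, then `x / D` lies in the dual lattice, so an
element of the stable orthogonal group moves `x` by an element of `D L`. -/
theorem exists_apply_eq_add_smul {S : Matrix ι ι ℤ} {D : ℕ} (hD : 0 < D)
    {g : (ι → ℤ) ≃ₗ[ℤ] (ι → ℤ)} (hg : g ∈ stableOrthogonalGroup S) {x : ι → ℤ}
    (hx : ∀ z, (D : ℤ) ∣ form S x z) : ∃ l, g x = x + (D : ℤ) • l := by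
  have hD0 : (D : ℚ) ≠ 0 := by positivity
  obtain ⟨l, hl⟩ := hg.2 ((D : ℚ)⁻¹ • toRat x) fun z => by
    obtain ⟨k, hk⟩ := hx z
    refine ⟨k, ?_⟩
    have h : formOver ℚ S (toRat x) (toRat z) = (form S x z : ℚ) := formOver_castVec ℚ S x z
    rw [map_smul, LinearMap.smul_apply, h, hk]
    simp [hD0]
  refine ⟨l, ?_⟩
  rw [map_smul, extend_toRat] at hl
  funext i
  have hi := congrFun hl i
  simp only [toRat, Pi.sub_apply, Pi.smul_apply, smul_eq_mul] at hi
  field_simp at hi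
  have h2 : ((g x i - x i : ℤ) : ℚ) = ((D * l i : ℤ) : ℚ) := by push_cast; linarith
  have h3 : g x i - x i = D * l i := by exact_mod_cast h2
  simp only [Pi.add_apply, Pi.smul_apply, smul_eq_mul]
  linarith

/-! ### Divisors and orbits -/

theorem divisor_dvd (S : Matrix ι ι ℤ) (r y : ι → ℤ) : (divisor S r : ℤ) ∣ form S r y := by
  rw [← Ideal.mem_span_singleton, ← range_form_eq_span_divisor]
  exact ⟨y, rfl⟩

theorem exists_form_eq_divisor (S : Matrix ι ι ℤ) (r : ι → ℤ) :
    ∃ y, form S r y = divisor S r := by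
  have h : (divisor S r : ℤ) ∈ Ideal.span {(divisor S r : ℤ)} := Ideal.mem_span_singleton_self _
  rw [← range_form_eq_span_divisor] at h
  exact h

theorem divisor_eq {S : Matrix ι ι ℤ} {r y : ι → ℤ} {D : ℕ} (h : ∀ z, (D : ℤ) ∣ form S r z)
    (hy : form S r y = D) : divisor S r = D := by
  obtain ⟨z, hz⟩ := exists_form_eq_divisor S r
  exact Nat.dvd_antisymm (by exact_mod_cast hy ▸ divisor_dvd S r y)
    (by exact_mod_cast hz ▸ h z)

/-- Eichler's criterion for the group of stable isometries that preserve the components of the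
type IV domain. -/
theorem exists_stableOrthogonalGroupPlus_apply_eq {S : Matrix ι ι ℤ} (hsymm : S.IsSymm)
    (heven : ∀ x, Even (form S x x)) {e f e₁ f₁ : ι → ℤ} (H : HyperbolicPairs (form S) e f e₁ f₁)
    {D : ℕ} (hD : 0 < D) {v w : ι → ℤ} (hv : divisor S v = D) (hw : divisor S w = D)
    (hnorm : form S v v = form S w w) (hvw : ∃ l, w = v + (D : ℤ) • l) :
    ∃ g ∈ stableOrthogonalGroupPlus S, g v = w := by
  obtain ⟨y, hy⟩ := exists_form_eq_divisor S v
  obtain ⟨z, hz⟩ := exists_form_eq_divisor S w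
  exact eichler_criterion (form_comm hsymm) heven H (containsTransvections hsymm)
    (fun g hg => hg.1.1) hD (fun g hg x hx => exists_apply_eq_add_smul hD hg.2 hx)
    (hv ▸ divisor_dvd S v) (hv ▸ hy) (hw ▸ divisor_dvd S w) (hw ▸ hz) hnorm hvw

end Gram

section Orbits

variable {ι : Type}

theorem ncard_orbits_eq_one {G : Subgroup ((ι → ℤ) ≃ₗ[ℤ] (ι → ℤ))} {V : Set (ι → ℤ)}
    {v : ι → ℤ} (hv : v ∈ V) (h : ∀ w ∈ V, ∃ g ∈ G, g w = v) : (orbits G V).ncard = 1 := by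
  rw [Set.ncard_eq_one]
  refine ⟨MulAction.orbit G v, Set.eq_singleton_iff_unique_mem.mpr ⟨⟨v, hv, rfl⟩, ?_⟩⟩
  rintro _ ⟨w, hw, rfl⟩
  obtain ⟨g, hg, rfl⟩ := h w hw
  exact (MulAction.orbit_eq_iff.mpr ⟨(⟨g, hg⟩ : G), rfl⟩).symm

/-- The number of orbits is the number of values of a complete invariant. -/
theorem ncard_orbits_eq_ncard_image {G : Subgroup ((ι → ℤ) ≃ₗ[ℤ] (ι → ℤ))} {V : Set (ι → ℤ)}
    {α : Type*} (φ : (ι → ℤ) → α)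
    (h : ∀ v ∈ V, ∀ w ∈ V, φ v = φ w ↔ ∃ g ∈ G, g v = w) :
    (orbits G V).ncard = (φ '' V).ncard := by
  have h' : ∀ v ∈ V, ∀ w ∈ V, MulAction.orbit G v = MulAction.orbit G w ↔ φ v = φ w := by
    intro v hv w hw
    rw [eq_comm (a := φ v), h w hw v hv, MulAction.orbit_eq_iff]
    exact ⟨fun ⟨g, hg⟩ => ⟨g.1, g.2, hg⟩, fun ⟨g, hg, e⟩ => ⟨⟨g, hg⟩, e⟩⟩
  refine Set.ncard_congr (fun o ho => φ ho.choose) ?_ ?_ ?_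
  · exact fun o ho => ⟨_, ho.choose_spec.1, rfl⟩
  · intro o o' ho ho' e
    rw [← ho.choose_spec.2, ← ho'.choose_spec.2]
    exact (h' _ ho.choose_spec.1 _ ho'.choose_spec.1).mpr e
  · rintro _ ⟨v, hv, rfl⟩
    have ho : MulAction.orbit G v ∈ orbits G V := ⟨v, hv, rfl⟩
    exact ⟨_, ho, (h' _ ho.choose_spec.1 _ hv).mp ho.choose_spec.2⟩

end Orbits

/-! ### Isometries between Gram matrices -/

section Isometries

variable {ι κ : Type} [Fintype ι] [DecidableEq ι] [Fintype κ] [DecidableEq κ]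
  {ι' κ' : Type} [Fintype ι'] [DecidableEq ι'] [Fintype κ'] [DecidableEq κ']

theorem form_orthSum (S : Matrix ι ι ℤ) (T : Matrix κ κ ℤ) (x y : ι ⊕ κ → ℤ) :
    form (orthSum S T) x y =
      form S (x ∘ Sum.inl) (y ∘ Sum.inl) + form T (x ∘ Sum.inr) (y ∘ Sum.inr) := by
  simp [form, orthSum, Matrix.toBilin'_apply, Fintype.sum_sum_type]

theorem form_orthSum_elim (S : Matrix ι ι ℤ) (T : Matrix κ κ ℤ) (x x' : ι → ℤ) (y y' : κ → ℤ) :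
    form (orthSum S T) (Sum.elim x y) (Sum.elim x' y') = form S x x' + form T y y' := by
  rw [form_orthSum]; rfl

theorem form_binary (a b c d : ℤ) (x y : Fin 2 → ℤ) :
    form !![a, b; c, d] x y =
      a * x 0 * y 0 + b * x 0 * y 1 + c * x 1 * y 0 + d * x 1 * y 1 := by
  simp [form, Matrix.toBilin'_apply, Fin.sum_univ_two]
  ring

theorem form_hypU (x y : Fin 2 → ℤ) : form hypU x y = x 0 * y 1 + x 1 * y 0 := by
  simp [hypU, form_binary]

theorem form_rankOne (a : ℤ) (x y : Fin 1 → ℤ) : form (rankOne a) x y = a * x 0 * y 0 := by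
  simp [rankOne, form, Matrix.toBilin'_apply, mul_comm a]

theorem equivalent_of_linearEquiv {S : Matrix ι ι ℤ} {T : Matrix κ κ ℤ}
    (g : (ι → ℤ) ≃ₗ[ℤ] (κ → ℤ)) (h : ∀ x y, form T (g x) (g y) = form S x y) :
    (form S).Equivalent (form T) :=
  ⟨{ g with map_app' := fun _ _ => h _ _ }⟩

theorem equivalent_of_reindex {S : Matrix ι ι ℤ} {T : Matrix κ κ ℤ} (e : κ ≃ ι)
    (h : ∀ i j, T i j = S (e i) (e j)) : (form S).Equivalent (form T) := by
  refine equivalent_of_linearEquiv (LinearEquiv.funCongrLeft ℤ ℤ e) fun x y => ?_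
  simp only [form, Matrix.toBilin'_apply, h, LinearEquiv.funCongrLeft_apply,
    LinearMap.funLeft_apply]
  rw [← e.sum_comp]
  exact Finset.sum_congr rfl fun i _ =>
    e.sum_comp fun j => x (e i) * S (e i) j * y j

theorem equivalent_orthSum {S : Matrix ι ι ℤ} {S' : Matrix ι' ι' ℤ} {T : Matrix κ κ ℤ}
    {T' : Matrix κ' κ' ℤ} (hS : (form S).Equivalent (form S'))
    (hT : (form T).Equivalent (form T')) :
    (form (orthSum S T)).Equivalent (form (orthSum S' T')) := by
  obtain ⟨g⟩ := hS
  obtain ⟨h⟩ := hT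
  refine equivalent_of_linearEquiv
    ((LinearEquiv.sumArrowLequivProdArrow ι κ ℤ ℤ).trans
      ((LinearEquiv.prodCongr g.toLinearEquiv h.toLinearEquiv).trans
        (LinearEquiv.sumArrowLequivProdArrow ι' κ' ℤ ℤ).symm)) fun x y => ?_
  rw [form_orthSum S T, form_orthSum, ← g.map_app, ← h.map_app]
  rfl

theorem equivalent_orthSum_assoc (S : Matrix ι ι ℤ) (T : Matrix κ κ ℤ) (T' : Matrix κ' κ' ℤ) :
    (form (orthSum S (orthSum T T'))).Equivalent (form (orthSum (orthSum S T) T')) := by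
  refine equivalent_of_reindex (Equiv.sumAssoc _ _ _) ?_
  rintro ((i | i) | i) ((j | j) | j) <;> rfl

theorem equivalent_orthSum_right_comm (S : Matrix ι ι ℤ) (T : Matrix κ κ ℤ) (T' : Matrix κ' κ' ℤ) :
    (form (orthSum (orthSum S T) T')).Equivalent (form (orthSum (orthSum S T') T)) := by
  let e : (ι ⊕ κ') ⊕ κ ≃ (ι ⊕ κ) ⊕ κ' :=
    { toFun := Sum.elim (Sum.elim (Sum.inl ∘ Sum.inl) Sum.inr) (Sum.inl ∘ Sum.inr)
      invFun := Sum.elim (Sum.elim (Sum.inl ∘ Sum.inl) Sum.inr) (Sum.inl ∘ Sum.inr)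
      left_inv := by rintro ((i | i) | i) <;> rfl
      right_inv := by rintro ((i | i) | i) <;> rfl }
  refine equivalent_of_reindex e ?_
  rintro ((i | i) | i) ((j | j) | j) <;> rfl

theorem equivalent_rankOne_add_rankOne (a b : ℤ) :
    (form !![a, 0; 0, b]).Equivalent (form (orthSum (rankOne a) (rankOne b))) := by
  refine equivalent_of_reindex (finSumFinEquiv (m := 1) (n := 1)) ?_
  rintro (i | i) (j | j) <;> fin_cases i <;> fin_cases j <;> rfl

/-- To identify the orthogonal complement of `r` with the lattice of Gram matrix `T`, it suffices
to give a linear isometry `φ` onto the complement, with a linear left inverse `ψ`. -/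
theorem complementIsometric_of_linearMap {S : Matrix ι ι ℤ} {T : Matrix κ κ ℤ} {r : ι → ℤ}
    (φ : (κ → ℤ) →ₗ[ℤ] (ι → ℤ)) (ψ : (ι → ℤ) →ₗ[ℤ] (κ → ℤ)) (hr : ∀ y, form S r (φ y) = 0)
    (hψφ : ∀ y, ψ (φ y) = y) (hφψ : ∀ x, form S r x = 0 → φ (ψ x) = x)
    (hform : ∀ y y', form S (φ y) (φ y') = form T y y') : ComplementIsometric S r T := by
  have hmem : ∀ x, x ∈ (form S).orthogonal (Submodule.span ℤ {r}) ↔ form S r x = 0 := fun x => by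
    rw [LinearMap.BilinForm.mem_orthogonal_iff]
    refine ⟨fun h => h r (Submodule.mem_span_singleton_self r), fun h n hn => ?_⟩
    obtain ⟨k, rfl⟩ := Submodule.mem_span_singleton.mp hn
    rw [map_smul, LinearMap.smul_apply, h, smul_zero]
  let g : (form S).orthogonal (Submodule.span ℤ {r}) ≃ₗ[ℤ] (κ → ℤ) :=
    LinearEquiv.ofLinearMap (ψ ∘ₗ Submodule.subtype _)
      (φ.codRestrict _ fun y => (hmem _).mpr (hr y))
      (LinearMap.ext fun y => hψφ y)
      (LinearMap.ext fun x => Subtype.ext (hφψ x ((hmem _).mp x.2)))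
  refine ⟨{ g with map_app' := fun x y => ?_ }⟩
  change form T (ψ x) (ψ y) = form S x y
  rw [← hform, hφψ _ ((hmem _).mp x.2), hφψ _ ((hmem _).mp y.2)]

theorem ComplementIsometric.trans {S : Matrix ι ι ℤ} {T : Matrix κ κ ℤ} {T' : Matrix κ' κ' ℤ}
    {r : ι → ℤ} (h : ComplementIsometric S r T) (h' : (form T).Equivalent (form T')) :
    ComplementIsometric S r T' :=
  LinearMap.BilinForm.Equivalent.trans h h'

/-- Isometries carry orthogonal complements to orthogonal complements. -/
theorem ComplementIsometric.of_apply {S : Matrix ι ι ℤ} {T : Matrix κ κ ℤ} {r r' : ι → ℤ}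
    {g : (ι → ℤ) ≃ₗ[ℤ] (ι → ℤ)} (hg : g ∈ orthogonalGroup S) (hr : g r = r')
    (h : ComplementIsometric S r' T) : ComplementIsometric S r T := by
  have hmem : ∀ x, g x ∈ (form S).orthogonal (Submodule.span ℤ {r'}) ↔
      x ∈ (form S).orthogonal (Submodule.span ℤ {r}) := fun x => by
    simp only [LinearMap.BilinForm.mem_orthogonal_iff, Submodule.mem_span_singleton,
      forall_exists_index, forall_apply_eq_imp_iff, ← hr, ← map_smul,
      hg _ x]
  let g' : (form S).orthogonal (Submodule.span ℤ {r}) ≃ₗ[ℤ]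
      (form S).orthogonal (Submodule.span ℤ {r'}) :=
    g.ofSubmodules _ _ (by
      ext y
      rw [Submodule.mem_map_equiv, ← hmem, g.apply_symm_apply])
  refine LinearMap.BilinForm.Equivalent.trans ⟨{ g' with map_app' := fun x y => ?_ }⟩ h
  exact hg x y

end Isometries

/-! ### Binary lattices of determinant `-1` -/

section Binary

theorem equivalent_binary {a b c a' b' c' : ℤ} (p q r s : ℤ) (hdet : (p * s - q * r) ^ 2 = 1)
    (ha : a' = a * p ^ 2 + 2 * b * p * r + c * r ^ 2)
    (hb : b' = a * p * q + b * (p * s + q * r) + c * r * s)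
    (hc : c' = a * q ^ 2 + 2 * b * q * s + c * s ^ 2) :
    (form !![a, b; b, c]).Equivalent (form !![a', b'; b', c']) := by
  have hdet' : (!![p, q; r, s] : Matrix (Fin 2) (Fin 2) ℤ).det * (p * s - q * r) = 1 := by
    rw [Matrix.det_fin_two_of, ← hdet]; ring
  have hu : IsUnit (!![p, q; r, s] : Matrix (Fin 2) (Fin 2) ℤ).det := .of_mul_eq_one _ hdet'
  refine LinearMap.BilinForm.Equivalent.symm (equivalent_of_linearEquiv
    (Matrix.toLinearEquiv' !![p, q; r, s] (Matrix.invertibleOfIsUnitDet _ hu)) fun x y => ?_)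
  have happ : ∀ x : Fin 2 → ℤ,
      Matrix.toLinearEquiv' !![p, q; r, s] (Matrix.invertibleOfIsUnitDet _ hu) x =
        !![p, q; r, s] *ᵥ x := fun _ => rfl
  rw [happ, happ, form_binary, form_binary, ha, hb, hc]
  simp [Matrix.mulVec, dotProduct, Fin.sum_univ_two]
  ring

/-- A binary form of determinant `-1` has a primitive isotropic vector. -/
theorem exists_isotropic {A B C : ℤ} (h : B ^ 2 - A * C = 1) :
    ∃ p r, IsCoprime p r ∧ A * p ^ 2 + 2 * B * p * r + C * r ^ 2 = 0 := by
  by_cases hA : A = 0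
  · exact ⟨1, 0, isCoprime_one_left, by simp [hA]⟩
  · -- the vector `(1 - B, A)` is isotropic; divide it by the greatest common divisor
    have hg : 0 < Int.gcd (1 - B) A := Int.gcd_pos_of_ne_zero_right _ hA
    obtain ⟨p, r, hpr, hp, hr⟩ := Int.exists_gcd_one hg
    refine ⟨p, r, Int.isCoprime_iff_gcd_eq_one.mpr hpr, ?_⟩
    set g : ℤ := (Int.gcd (1 - B) A : ℤ) with hgdef
    have hg0 : g ^ 2 ≠ 0 := by positivity
    refine (mul_eq_zero.mp (?_ : g ^ 2 * (A * p ^ 2 + 2 * B * p * r + C * r ^ 2) = 0)).resolve_left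
      hg0
    calc g ^ 2 * (A * p ^ 2 + 2 * B * p * r + C * r ^ 2)
        = A * (p * g) ^ 2 + 2 * B * (p * g) * (r * g) + C * (r * g) ^ 2 := by ring
      _ = A * (1 - B) ^ 2 + 2 * B * (1 - B) * A + C * A ^ 2 := by rw [← hp, ← hr]
      _ = A * (1 - (B ^ 2 - A * C)) := by ring
      _ = 0 := by rw [h]; ring

/-- A multiple of a binary form of determinant `-1` is equivalent to the same multiple of
`(0, 1; 1, t)`; here `t` is even if the form is even. -/
theorem exists_equivalent_isotropic (n : ℤ) {A B C : ℤ} (h : B ^ 2 - A * C = 1) :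
    ∃ t : ℤ, (Even A → Even C → Even t) ∧
      (form !![n * A, n * B; n * B, n * C]).Equivalent (form !![0, n; n, n * t]) := by
  obtain ⟨p, r, ⟨u, v, huv⟩, hiso⟩ := exists_isotropic h
  set β := A * p * (-v) + B * (p * u + (-v) * r) + C * r * u with hβdef
  set t := A * (-v) ^ 2 + 2 * B * (-v) * u + C * u ^ 2 with htdef
  have hdet : p * u - (-v) * r = 1 := by linarith
  have hβ : β ^ 2 = 1 := by
    have : β ^ 2 - (A * p ^ 2 + 2 * B * p * r + C * r ^ 2) * t =
        (B ^ 2 - A * C) * (p * u - (-v) * r) ^ 2 := by rw [hβdef, htdef]; ring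
    rw [hiso, h, hdet] at this
    linarith
  refine ⟨t, fun hA hC => ?_, ?_⟩
  · rw [htdef]
    exact ((hA.mul_right _).add (by simp [mul_assoc])).add (hC.mul_right _)
  · have h1 : (form !![n * A, n * B; n * B, n * C]).Equivalent
        (form !![0, n * β; n * β, n * t]) :=
      equivalent_binary p (-v) r u (by rw [hdet]; ring)
        (by linear_combination -n * hiso) (by rw [hβdef]; ring) (by rw [htdef]; ring)
    refine h1.trans (equivalent_binary β 0 0 1 (by linear_combination hβ) (by ring) ?_ (by ring))
    linear_combination -n * hβ

theorem equivalent_hyperbolic_of_even (n : ℤ) {A B C : ℤ} (h : B ^ 2 - A * C = 1) (hA : Even A)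
    (hC : Even C) : (form !![n * A, n * B; n * B, n * C]).Equivalent (form !![0, n; n, 0]) := by
  obtain ⟨t, ht, he⟩ := exists_equivalent_isotropic n h
  obtain ⟨k, rfl⟩ := ht hA hC
  exact he.trans (equivalent_binary 1 (-k) 0 1 (by ring) (by ring) (by ring) (by ring))

/-- Indefinite unimodular binary forms, up to a multiple: the even one and the odd one. -/
theorem equivalent_hyperbolic_or_diagonal (n : ℤ) {A B C : ℤ} (h : B ^ 2 - A * C = 1) :
    (form !![n * A, n * B; n * B, n * C]).Equivalent (form !![0, n; n, 0]) ∨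
      (form !![n * A, n * B; n * B, n * C]).Equivalent (form !![n, 0; 0, -n]) := by
  obtain ⟨t, -, he⟩ := exists_equivalent_isotropic n h
  obtain ⟨k, rfl | rfl⟩ := Int.even_or_odd' t
  · exact .inl (he.trans (equivalent_binary 1 (-k) 0 1 (by ring) (by ring) (by ring) (by ring)))
  · exact .inr (he.trans (equivalent_binary (-k) (-k - 1) 1 1 (by ring) (by ring) (by ring)
      (by ring)))

end Binary

/-! ### The lattices `II` and `L` -/

theorem isSymm_orthSum {ι κ : Type} {S : Matrix ι ι ℤ} {T : Matrix κ κ ℤ} (hS : S.IsSymm)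
    (hT : T.IsSymm) : (orthSum S T).IsSymm := by
  rw [orthSum, Matrix.IsSymm, Matrix.fromBlocks_transpose, hS.eq, hT.eq]
  simp

section Lattices

variable {ι κ : Type} [Fintype ι] [DecidableEq ι] [Fintype κ] [DecidableEq κ]

theorem even_form_orthSum {S : Matrix ι ι ℤ} {T : Matrix κ κ ℤ} (hS : ∀ x, Even (form S x x))
    (hT : ∀ x, Even (form T x x)) (x : ι ⊕ κ → ℤ) : Even (form (orthSum S T) x x) := by
  rw [form_orthSum]
  exact (hS _).add (hT _)

theorem even_form_add_transpose (A : Matrix ι ι ℤ) (x : ι → ℤ) : Even (form (A + Aᵀ) x x) := by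
  rw [form, Matrix.toBilin'_apply', Matrix.add_mulVec, dotProduct_add, Matrix.mulVec_transpose,
    Matrix.dotProduct_mulVec, dotProduct_comm x (x ᵥ* A)]
  exact ⟨_, rfl⟩

/-- In a unimodular lattice a vector whose products are all divisible by `D` is divisible by
`D`. -/
theorem exists_eq_smul_of_dvd {S : Matrix ι ι ℤ} (hS : IsUnit S.det) {D : ℤ} {x : ι → ℤ}
    (hx : ∀ z, D ∣ form S x z) : ∃ l, x = D • l := by
  choose k hk using fun i => hx (Pi.single i 1)
  refine ⟨k ᵥ* S⁻¹, ?_⟩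
  have h : x ᵥ* S = D • k := by
    funext i
    rw [Pi.smul_apply, smul_eq_mul, ← hk, form, Matrix.toBilin'_apply', Matrix.dotProduct_mulVec]
    simp
  rw [← Matrix.smul_vecMul, ← h, Matrix.vecMul_vecMul, Matrix.mul_nonsing_inv _ hS,
    Matrix.vecMul_one]

theorem isSymm_mE8neg (m : ℕ) : (mE8neg m).IsSymm := by
  rw [mE8neg, Matrix.IsSymm, Matrix.blockDiagonal_transpose]
  simp

theorem even_form_mE8neg (m : ℕ) (x : Fin 8 × Fin m → ℤ) : Even (form (mE8neg m) x x) := by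
  -- the Gram matrix is the sum of a triangular matrix and its transpose
  let A : Matrix (Fin 8) (Fin 8) ℤ := Matrix.of fun i j =>
    if i < j then -CartanMatrix.E₈ i j else if i = j then -1 else 0
  have hA : -CartanMatrix.E₈ = A + Aᵀ := by decide
  have h : mE8neg m = Matrix.blockDiagonal (fun _ : Fin m => A) +
      (Matrix.blockDiagonal fun _ : Fin m => A)ᵀ := by
    rw [Matrix.blockDiagonal_transpose, ← Matrix.blockDiagonal_add, mE8neg, hA]
    rfl
  rw [h]
  exact even_form_add_transpose _ x

theorem isUnit_det_mE8neg (m : ℕ) : IsUnit (mE8neg m).det := by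
  rw [mE8neg, Matrix.det_blockDiagonal, Matrix.det_neg, CartanMatrix.E₈_det]
  simp

theorem isSymm_hypU : hypU.IsSymm := by
  rw [Matrix.IsSymm]; decide

theorem even_form_hypU (x : Fin 2 → ℤ) : Even (form hypU x x) := by
  rw [form_hypU]
  exact ⟨x 0 * x 1, by ring⟩

theorem isSymm_latII (m : ℕ) : (latII m).IsSymm :=
  isSymm_orthSum (isSymm_orthSum isSymm_hypU isSymm_hypU) (isSymm_mE8neg m)

theorem even_form_latII (m : ℕ) (x : (Fin 2 ⊕ Fin 2) ⊕ Fin 8 × Fin m → ℤ) :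
    Even (form (latII m) x x) :=
  even_form_orthSum (even_form_orthSum even_form_hypU even_form_hypU) (even_form_mE8neg m) x

theorem isUnit_det_latII (m : ℕ) : IsUnit (latII m).det := by
  have hU : IsUnit hypU.det := by rw [hypU, Matrix.det_fin_two_of]; decide
  rw [latII, orthSum, orthSum, Matrix.det_fromBlocks_zero₂₁, Matrix.det_fromBlocks_zero₂₁]
  exact (hU.mul hU).mul (isUnit_det_mE8neg m)

theorem isSymm_latL (m d : ℕ) : (latL m d).IsSymm := by
  refine isSymm_orthSum (isSymm_latII m) (Matrix.ext fun i j => ?_)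
  rw [Subsingleton.elim i j, Matrix.transpose_apply]

theorem even_form_latL (m d : ℕ) (x : ((Fin 2 ⊕ Fin 2) ⊕ Fin 8 × Fin m) ⊕ Fin 1 → ℤ) :
    Even (form (latL m d) x x) := by
  refine even_form_orthSum (even_form_latII m) (fun y => ?_) x
  rw [form_rankOne]
  exact ⟨-d * y 0 * y 0, by ring⟩

/-- The vector of `II` with coordinates `p` and `q` in the two hyperbolic planes. -/
def vecII (m : ℕ) (p q : Fin 2 → ℤ) : (Fin 2 ⊕ Fin 2) ⊕ Fin 8 × Fin m → ℤ :=
  Sum.elim (Sum.elim p q) 0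

theorem form_vecII_left (m : ℕ) (p q : Fin 2 → ℤ) (x : (Fin 2 ⊕ Fin 2) ⊕ Fin 8 × Fin m → ℤ) :
    form (latII m) (vecII m p q) x =
      p 0 * x (.inl (.inl 1)) + p 1 * x (.inl (.inl 0)) +
        (q 0 * x (.inl (.inr 1)) + q 1 * x (.inl (.inr 0))) := by
  rw [latII, form_orthSum, form_orthSum, form_hypU, form_hypU]
  simp [vecII, Sum.elim_comp_inr]

theorem form_vecII (m : ℕ) (p q p' q' : Fin 2 → ℤ) :
    form (latII m) (vecII m p q) (vecII m p' q') =
      p 0 * p' 1 + p 1 * p' 0 + (q 0 * q' 1 + q 1 * q' 0) :=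
  form_vecII_left m p q _

theorem hyperbolicPairs_latII (m : ℕ) : HyperbolicPairs (form (latII m)) (vecII m ![1, 0] 0)
    (vecII m ![0, 1] 0) (vecII m 0 ![1, 0]) (vecII m 0 ![0, 1]) := by
  constructor <;> simp [form_vecII]

theorem hyperbolicPairs_orthSum {S : Matrix ι ι ℤ} (T : Matrix κ κ ℤ) {e f e₁ f₁ : ι → ℤ}
    (H : HyperbolicPairs (form S) e f e₁ f₁) :
    HyperbolicPairs (form (orthSum S T)) (Sum.elim e 0) (Sum.elim f 0) (Sum.elim e₁ 0)
      (Sum.elim f₁ 0) := by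
  constructor <;>
  simp [form_orthSum_elim, H.ee, H.ff, H.ef, H.ee₁, H.ef₁, H.fe₁, H.ff₁, H.e₁e₁, H.f₁f₁, H.e₁f₁]

end Lattices

section Unimodular

variable {m : ℕ}

/-- Primitive vectors of the unimodular lattice `II` have divisor `1`. -/
theorem divisor_latII_eq_one {r : (Fin 2 ⊕ Fin 2) ⊕ Fin 8 × Fin m → ℤ} (hr : IsPrimitive r) :
    divisor (latII m) r = 1 := by
  obtain ⟨l, hl⟩ := exists_eq_smul_of_dvd (isUnit_det_latII m) (divisor_dvd (latII m) r)
  exact Int.ofNat_isUnit.mp (hr _ l hl) |> Nat.isUnit_iff.mp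

theorem isPrimitive_of_apply_eq_one {ι : Type} {r : ι → ℤ} (i : ι) (h : r i = 1) :
    IsPrimitive r := fun k s hks => by
  rw [hks, Pi.smul_apply, smul_eq_mul] at h
  exact .of_mul_eq_one _ h

theorem isKVector_vecII : IsKVector (latII m) (-2) (vecII m ![1, -1] 0) :=
  ⟨isPrimitive_of_apply_eq_one (.inl (.inl 0)) rfl, by simp [form_vecII]⟩

theorem exists_apply_eq_vecII {r : (Fin 2 ⊕ Fin 2) ⊕ Fin 8 × Fin m → ℤ}
    (hr : IsKVector (latII m) (-2) r) :
    ∃ g ∈ stableOrthogonalGroupPlus (latII m), g r = vecII m ![1, -1] 0 :=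
  exists_stableOrthogonalGroupPlus_apply_eq (isSymm_latII m) (even_form_latII m)
    (hyperbolicPairs_latII m) one_pos (divisor_latII_eq_one hr.1)
    (divisor_latII_eq_one isKVector_vecII.1) (by rw [hr.2, isKVector_vecII.2])
    ⟨vecII m ![1, -1] 0 - r, by simp⟩

/-- The orthogonal complement of `e - f` is spanned by `e + f` and the orthogonal complement of the
hyperbolic plane of `e` and `f`. -/
theorem complementIsometric_vecII :
    ComplementIsometric (latII m) (vecII m ![1, -1] 0) (latKII m) := by
  let φ : ((Fin 2 ⊕ Fin 8 × Fin m) ⊕ Fin 1 → ℤ) →ₗ[ℤ] ((Fin 2 ⊕ Fin 2) ⊕ Fin 8 × Fin m → ℤ) :=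
    { toFun := fun y => Sum.elim
        (Sum.elim ![y (.inr 0), y (.inr 0)] (fun i => y (.inl (.inl i)))) fun i => y (.inl (.inr i))
      map_add' := fun x y => by
        funext i; rcases i with (i | i) | i <;> [fin_cases i; skip; skip] <;> rfl
      map_smul' := fun c x => by
        funext i; rcases i with (i | i) | i <;> [fin_cases i; skip; skip] <;> rfl }
  let ψ : ((Fin 2 ⊕ Fin 2) ⊕ Fin 8 × Fin m → ℤ) →ₗ[ℤ] ((Fin 2 ⊕ Fin 8 × Fin m) ⊕ Fin 1 → ℤ) :=
    { toFun := fun x => Sum.elim (Sum.elim (fun i => x (.inl (.inr i))) fun i => x (.inr i))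
        fun _ => x (.inl (.inl 0))
      map_add' := fun x y => by funext i; rcases i with (i | i) | i <;> rfl
      map_smul' := fun c x => by funext i; rcases i with (i | i) | i <;> rfl }
  refine complementIsometric_of_linearMap φ ψ (fun y => ?_) (fun y => ?_) (fun x hx => ?_)
    (fun y y' => ?_)
  · rw [form_vecII_left]; simp [φ]
  · funext i
    rcases i with (i | i) | i
    · rfl
    · rfl
    · rw [Subsingleton.elim i 0]; rfl
  · rw [form_vecII_left] at hx
    simp only [cons_val_zero, cons_val_one, Pi.zero_apply] at hx
    have hx' : x (.inl (.inl 0)) = x (.inl (.inl 1)) := by linarith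
    funext i
    rcases i with (i | i) | i
    · fin_cases i
      · rfl
      · exact hx'
    · rfl
    · rfl
  · simp only [latII, latKII, form_orthSum, form_hypU, form_rankOne]
    simp only [φ, LinearMap.coe_mk, AddHom.coe_mk, Function.comp_def, Sum.elim_inl, Sum.elim_inr,
      cons_val_zero, cons_val_one]
    ring

end Unimodular

/-! ### Normal forms in `L` -/

section NormalForm

variable {m d : ℕ}

/-- The vector `D (e + b f) + x h` of `L`, where `(e, f)` is the first hyperbolic pair and `h`
generates the summand of rank one. -/
def stdVec (m : ℕ) (D b x : ℤ) : ((Fin 2 ⊕ Fin 2) ⊕ Fin 8 × Fin m) ⊕ Fin 1 → ℤ :=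
  Sum.elim (vecII m ![D, D * b] 0) fun _ => x

theorem form_latL (x y : ((Fin 2 ⊕ Fin 2) ⊕ Fin 8 × Fin m) ⊕ Fin 1 → ℤ) :
    form (latL m d) x y =
      form (latII m) (x ∘ .inl) (y ∘ .inl) + -2 * (d : ℤ) * x (.inr 0) * y (.inr 0) := by
  rw [latL, form_orthSum, form_rankOne]; rfl

theorem form_stdVec_left (D b x : ℤ) (y : ((Fin 2 ⊕ Fin 2) ⊕ Fin 8 × Fin m) ⊕ Fin 1 → ℤ) :
    form (latL m d) (stdVec m D b x) y =
      D * y (.inl (.inl (.inl 1))) + D * b * y (.inl (.inl (.inl 0))) -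
        2 * d * x * y (.inr 0) := by
  have h : stdVec m D b x ∘ .inl = vecII m ![D, D * b] 0 := rfl
  rw [form_latL, h, form_vecII_left]
  simp [stdVec]
  ring

theorem form_stdVec (D b x : ℤ) :
    form (latL m d) (stdVec m D b x) (stdVec m D b x) = 2 * D ^ 2 * b - 2 * d * x ^ 2 := by
  rw [form_stdVec_left]
  simp [stdVec, vecII]
  ring

theorem divisor_stdVec {D : ℕ} {b x : ℤ} (h : (D : ℤ) ∣ 2 * d * x) :
    divisor (latL m d) (stdVec m D b x) = D := by
  refine divisor_eq (y := Sum.elim (vecII m ![0, 1] 0) 0) (fun z => ?_) ?_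
  · rw [form_stdVec_left]
    exact dvd_sub (dvd_add (dvd_mul_right _ _) ((dvd_mul_right _ _).mul_right _)) (h.mul_right _)
  · rw [form_stdVec_left]
    simp [vecII]

theorem isPrimitive_stdVec {D b x : ℤ} (h : IsCoprime D x) : IsPrimitive (stdVec m D b x) :=
  fun k s hks => by
    have h1 : D = k * s (.inl (.inl (.inl 0))) := congrFun hks (.inl (.inl (.inl 0)))
    have h2 : x = k * s (.inr 0) := congrFun hks (.inr 0)
    exact h.isUnit_of_dvd' ⟨_, h1⟩ ⟨_, h2⟩

/-- A vector of divisor `D` in `L` is `D l + x h` with `l` in the unimodular summand. -/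
theorem exists_comp_inl_eq_smul {r : ((Fin 2 ⊕ Fin 2) ⊕ Fin 8 × Fin m) ⊕ Fin 1 → ℤ} {D : ℕ}
    (hr : divisor (latL m d) r = D) :
    ∃ l, r ∘ .inl = (D : ℤ) • l ∧ (D : ℤ) ∣ 2 * d * r (.inr 0) := by
  have h := hr ▸ divisor_dvd (latL m d) r
  obtain ⟨l, hl⟩ := exists_eq_smul_of_dvd (isUnit_det_latII m) (D := D) (x := r ∘ .inl)
    fun z => by
      have hz := h (Sum.elim z 0)
      rw [form_latL] at hz
      simpa using hz
  refine ⟨l, hl, ?_⟩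
  have hz := h (Sum.elim 0 1)
  rw [form_latL] at hz
  simpa [mul_assoc] using hz

/-- Two vectors of `L` with the same norm and divisor `D` whose coordinates in the rank one summand
agree modulo `D` lie in the same orbit. -/
theorem exists_apply_eq_of_modEq {r r' : ((Fin 2 ⊕ Fin 2) ⊕ Fin 8 × Fin m) ⊕ Fin 1 → ℤ} {D : ℕ}
    (hD : 0 < D) (hr : divisor (latL m d) r = D) (hr' : divisor (latL m d) r' = D)
    (hnorm : form (latL m d) r r = form (latL m d) r' r')
    (h : (D : ℤ) ∣ r' (.inr 0) - r (.inr 0)) :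
    ∃ g ∈ stableOrthogonalGroupPlus (latL m d), g r = r' := by
  obtain ⟨l, hl, -⟩ := exists_comp_inl_eq_smul hr
  obtain ⟨l', hl', -⟩ := exists_comp_inl_eq_smul hr'
  obtain ⟨k, hk⟩ := h
  refine exists_stableOrthogonalGroupPlus_apply_eq (isSymm_latL m d) (even_form_latL m d)
    (hyperbolicPairs_orthSum _ (hyperbolicPairs_latII m)) hD hr hr' hnorm
    ⟨Sum.elim (l' - l) fun _ => k, ?_⟩
  funext i
  rcases i with i | i
  · have h1 := congrFun hl i
    have h2 := congrFun hl' i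
    simp only [Function.comp_apply, Pi.smul_apply, smul_eq_mul] at h1 h2
    simp [h1, h2]
    ring
  · rw [Subsingleton.elim i 0]
    simp only [Pi.add_apply, Pi.smul_apply, Sum.elim_inr, smul_eq_mul]
    linarith

/-- Every vector of divisor `D` is equivalent to a vector `D (e + b f) + x h`. -/
theorem exists_stdVec {r : ((Fin 2 ⊕ Fin 2) ⊕ Fin 8 × Fin m) ⊕ Fin 1 → ℤ} {D : ℕ}
    (hD : 0 < D) (hr : divisor (latL m d) r = D) : ∃ b,
      (D : ℤ) ∣ 2 * d * r (.inr 0) ∧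
      form (latL m d) r r = 2 * D ^ 2 * b - 2 * d * r (.inr 0) ^ 2 ∧
      ∃ g ∈ stableOrthogonalGroupPlus (latL m d), g r = stdVec m D b (r (.inr 0)) := by
  obtain ⟨l, hl, hdvd⟩ := exists_comp_inl_eq_smul hr
  obtain ⟨b, hb⟩ := even_form_latII m l
  have hnorm : form (latL m d) r r = 2 * D ^ 2 * b - 2 * d * r (.inr 0) ^ 2 := by
    rw [form_latL, hl]
    simp only [map_smul, LinearMap.smul_apply, smul_eq_mul, hb]
    ring
  refine ⟨b, hdvd, hnorm, exists_apply_eq_of_modEq hD hr (divisor_stdVec hdvd)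
    (by rw [hnorm, form_stdVec]) ?_⟩
  simp [stdVec]

/-- The orthogonal complement of `D (e + b f) + x h`, where `2 d x = D t`: in the span of `e`, `f`
and `h` it is spanned by `e - b f` and `h + t f`. -/
theorem complementIsometric_stdVec {D b x t : ℤ} (hD : D ≠ 0) (ht : 2 * d * x = D * t) :
    ComplementIsometric (latL m d) (stdVec m D b x)
      (orthSum (orthSum hypU (mE8neg m)) !![-2 * b, t; t, -2 * (d : ℤ)]) := by
  let φ : ((Fin 2 ⊕ Fin 8 × Fin m) ⊕ Fin 2 → ℤ) →ₗ[ℤ]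
      (((Fin 2 ⊕ Fin 2) ⊕ Fin 8 × Fin m) ⊕ Fin 1 → ℤ) :=
    { toFun := fun y => Sum.elim (Sum.elim
        (Sum.elim ![y (.inr 0), t * y (.inr 1) - b * y (.inr 0)] (fun i => y (.inl (.inl i))))
          fun i => y (.inl (.inr i))) fun _ => y (.inr 1)
      map_add' := fun x y => by
        funext i; rcases i with ((i | i) | i) | i <;> [fin_cases i; skip; skip; skip] <;>
          simp; ring
      map_smul' := fun c x => by
        funext i; rcases i with ((i | i) | i) | i <;> [fin_cases i; skip; skip; skip] <;>
          simp; ring }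
  let ψ : (((Fin 2 ⊕ Fin 2) ⊕ Fin 8 × Fin m) ⊕ Fin 1 → ℤ) →ₗ[ℤ]
      ((Fin 2 ⊕ Fin 8 × Fin m) ⊕ Fin 2 → ℤ) :=
    { toFun := fun x => Sum.elim
        (Sum.elim (fun i => x (.inl (.inl (.inr i)))) fun i => x (.inl (.inr i)))
        ![x (.inl (.inl (.inl 0))), x (.inr 0)]
      map_add' := fun x y => by
        funext i; rcases i with (i | i) | i <;> [skip; skip; fin_cases i] <;> rfl
      map_smul' := fun c x => by
        funext i; rcases i with (i | i) | i <;> [skip; skip; fin_cases i] <;> rfl }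
  refine complementIsometric_of_linearMap φ ψ (fun y => ?_) (fun y => ?_) (fun y hy => ?_)
    (fun y y' => ?_)
  · rw [form_stdVec_left]
    simp only [φ, LinearMap.coe_mk, AddHom.coe_mk, Sum.elim_inl, Sum.elim_inr, cons_val_zero,
      cons_val_one, ht]
    ring
  · funext i
    rcases i with (i | i) | i
    · rfl
    · rfl
    · fin_cases i <;> rfl
  · rw [form_stdVec_left, ht] at hy
    have hy' : t * y (.inr 0) - b * y (.inl (.inl (.inl 0))) = y (.inl (.inl (.inl 1))) :=
      mul_left_cancel₀ hD (by linarith)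
    funext i
    rcases i with ((i | i) | i) | i
    · fin_cases i
      · rfl
      · exact hy'
    · rfl
    · rfl
    · rw [Subsingleton.elim i 0]; rfl
  · simp only [latL, latII, form_orthSum, form_hypU, form_rankOne, form_binary]
    simp only [φ, LinearMap.coe_mk, AddHom.coe_mk, Function.comp_def, Sum.elim_inl, Sum.elim_inr,
      cons_val_zero, cons_val_one]
    ring

/-- The orthogonal complement of a vector `D l + x h` of divisor `D`. -/
theorem exists_complementIsometric {r : ((Fin 2 ⊕ Fin 2) ⊕ Fin 8 × Fin m) ⊕ Fin 1 → ℤ} {D : ℕ}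
    (hD : 0 < D) (hr : divisor (latL m d) r = D) : ∃ b t,
      2 * d * r (.inr 0) = D * t ∧
      form (latL m d) r r = 2 * D ^ 2 * b - 2 * d * r (.inr 0) ^ 2 ∧
      ComplementIsometric (latL m d) r
        (orthSum (orthSum hypU (mE8neg m)) !![-2 * b, t; t, -2 * (d : ℤ)]) := by
  obtain ⟨b, ⟨t, ht⟩, hb, g, hg, hgr⟩ := exists_stdVec hD hr
  exact ⟨b, t, ht, hb, .of_apply hg.1.1 hgr (complementIsometric_stdVec (by positivity) ht)⟩

end NormalForm

/-! ### Counting idempotents and square roots of one modulo `n` -/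

section Counting

/-- The number of roots of `X ^ 2 - a X - b` modulo `n`. -/
noncomputable def quadCount (a b : ℤ) (n : ℕ) : ℕ := {x : ZMod n | x * x = a * x + b}.ncard

theorem quadCount_mul (a b : ℤ) {k n : ℕ} (h : k.Coprime n) :
    quadCount a b (k * n) = quadCount a b k * quadCount a b n := by
  let e := ZMod.chineseRemainder h
  have himg : e '' {x : ZMod (k * n) | x * x = a * x + b} =
      {x : ZMod k | x * x = a * x + b} ×ˢ {x : ZMod n | x * x = a * x + b} := by
    ext z
    obtain ⟨x, rfl⟩ := e.surjective z
    rw [e.injective.mem_set_image, Set.mem_prod]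
    simp only [Set.mem_ofPred_eq]
    rw [← e.injective.eq_iff, Prod.ext_iff]
    simp
  rw [quadCount, ← Set.ncard_image_of_injective _ e.injective, himg, Set.ncard_prod]
  rfl

theorem intCast_mul_self_eq_iff (a b : ℤ) (n : ℕ) (x : ℤ) :
    (x : ZMod n) * x = a * x + b ↔ (n : ℤ) ∣ x * x - (a * x + b) := by
  rw [← ZMod.intCast_zmod_eq_zero_iff_dvd]
  push_cast
  rw [sub_eq_zero]

/-- A prime power dividing `y (y + 1)` divides one of the factors. -/
theorem pow_dvd_or_pow_dvd_add_one {p : ℤ} (hp : Prime p) (k : ℕ) {y : ℤ}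
    (h : p ^ k ∣ y * (y + 1)) : p ^ k ∣ y ∨ p ^ k ∣ y + 1 := by
  by_cases hy : p ∣ y
  · refine .inl (hp.pow_dvd_of_dvd_mul_right k (fun hy' => hp.not_isUnit ?_) h)
    exact isUnit_of_dvd_one ((Int.dvd_add_right hy).mp hy')
  · exact .inr (hp.pow_dvd_of_dvd_mul_left k hy h)

/-- There are `2 ^ ρ(n)` idempotents modulo `n`. -/
theorem quadCount_idempotent {n : ℕ} (hn : 0 < n) :
    quadCount 1 0 n = 2 ^ n.primeFactors.card := by
  induction n using Nat.recOnPosPrimePosCoprime with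
  | zero => exact absurd hn (lt_irrefl 0)
  | one =>
    rw [quadCount, Set.ncard_eq_toFinset_card', Nat.primeFactors_one]
    decide
  | prime_pow p k hp hk =>
    have : Fact (1 < p ^ k) := ⟨Nat.one_lt_pow hk.ne' hp.one_lt⟩
    have hset : {x : ZMod (p ^ k) | x * x = (1 : ℤ) * x + (0 : ℤ)} = {0, 1} := by
      ext x
      simp only [Int.cast_one, one_mul, Int.cast_zero, add_zero, Set.mem_ofPred_eq,
        Set.mem_insert_iff, Set.mem_singleton_iff]
      refine ⟨fun h => ?_, by rintro (rfl | rfl) <;> simp⟩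
      obtain ⟨y, rfl⟩ := ZMod.intCast_surjective x
      have h1 : ((p ^ k : ℕ) : ℤ) ∣ (y - 1) * (y - 1 + 1) := by
        rw [← ZMod.intCast_zmod_eq_zero_iff_dvd]
        push_cast
        linear_combination h
      push_cast at h1
      rcases pow_dvd_or_pow_dvd_add_one (Nat.prime_iff_prime_int.mp hp) k h1 with h2 | h2
      · right
        rw [← sub_eq_zero]
        exact_mod_cast
          (ZMod.intCast_zmod_eq_zero_iff_dvd (y - 1) (p ^ k)).mpr (by exact_mod_cast h2)
      · left
        rw [sub_add_cancel] at h2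
        exact (ZMod.intCast_zmod_eq_zero_iff_dvd y (p ^ k)).mpr (by exact_mod_cast h2)
    rw [quadCount, hset, Set.ncard_pair zero_ne_one, Nat.primeFactors_prime_pow hk.ne' hp]
    simp
  | coprime a b ha hb hab iha ihb =>
    rw [quadCount_mul _ _ hab, iha (by omega), ihb (by omega), hab.primeFactors_mul,
      Finset.card_union_of_disjoint hab.disjoint_primeFactors, pow_add]

/-- For odd `n`, the map `y ↦ 1 - 2 y` is a bijection from idempotents to square roots of one. -/
theorem quadCount_one_of_odd {n : ℕ} (hn : Odd n) :
    quadCount 0 1 n = 2 ^ n.primeFactors.card := by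
  rw [← quadCount_idempotent hn.pos]
  obtain ⟨u, hu⟩ : IsUnit (2 : ZMod n) := by
    have := (ZMod.isUnit_iff_coprime 2 n).mpr (Nat.coprime_two_left.mpr hn)
    exact_mod_cast this
  set v : ZMod n := ↑u⁻¹
  have hv : v * 2 = 1 := by rw [← hu]; exact u.inv_mul
  symm
  refine Set.ncard_congr (fun y _ => 1 - 2 * y) ?_ ?_ ?_
  · intro y hy
    simp only [Set.mem_ofPred_eq, Int.cast_one, Int.cast_zero] at hy ⊢
    linear_combination 4 * hy
  · intro y y' _ _ h
    linear_combination -v * h - (y - y') * hv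
  · intro x hx
    simp only [Set.mem_ofPred_eq, Int.cast_one, Int.cast_zero] at hx
    refine ⟨v * (1 - x), ?_, ?_⟩
    · simp only [Set.mem_ofPred_eq, Int.cast_one, Int.cast_zero]
      linear_combination v ^ 2 * hx + v * (1 - x) * hv
    · linear_combination -(1 - x) * hv

/-- Modulo `2 h`, where `h ≥ 4` is a power of two, the square roots of one are `±1` and `h ± 1`. -/
theorem quadCount_one_two_pow (j : ℕ) : quadCount 0 1 (2 ^ (j + 3)) = 4 := by
  have hmod : 2 ^ (j + 3) = 2 * 2 ^ (j + 2) := by ring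
  set h := 2 ^ (j + 2) with hh
  have h4 : h = 4 * 2 ^ j := by rw [hh]; ring
  have hpos : 0 < 2 ^ j := by positivity
  have hset : {x : ZMod (2 ^ (j + 3)) | x * x = (0 : ℤ) * x + (1 : ℤ)} =
      (fun k : ℕ => (k : ZMod (2 ^ (j + 3)))) ''
        (({1, h - 1, h + 1, 2 * h - 1} : Finset ℕ) : Set ℕ) := by
    ext x
    obtain ⟨y, rfl⟩ := ZMod.intCast_surjective x
    rw [Set.mem_ofPred_eq, intCast_mul_self_eq_iff]
    simp only [Finset.coe_insert, Finset.coe_singleton, Set.mem_image, Set.mem_insert_iff,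
      Set.mem_singleton_iff, exists_eq_or_imp, exists_eq_left]
    have hcast : ∀ k : ℕ, ((k : ZMod (2 ^ (j + 3))) = (y : ZMod (2 ^ (j + 3)))) ↔
        (2 * h : ℤ) ∣ y - k := fun k => by
      rw [← Int.cast_natCast, ZMod.intCast_eq_intCast_iff_dvd_sub, hmod]
      push_cast
      rfl
    simp only [hcast]
    rw [hmod, h4]
    push_cast [show 1 ≤ 4 * 2 ^ j by omega, show 1 ≤ 2 * (4 * 2 ^ j) by omega]
    constructor
    · rintro ⟨k, hk⟩
      have hodd : y % 2 = 1 := by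
        rcases Int.even_or_odd' y with ⟨z, rfl | rfl⟩
        · exfalso
          have : 2 * (2 * (z * z) - 4 * 2 ^ j * k) = 1 := by linear_combination hk
          omega
        · omega
      obtain ⟨z, rfl⟩ : ∃ z, y = 2 * z + 1 := ⟨y / 2, by omega⟩
      have hz : (2 : ℤ) ^ (j + 1) ∣ z * (z + 1) :=
        ⟨k, by rw [pow_succ]; linarith⟩
      rcases pow_dvd_or_pow_dvd_add_one Int.prime_two (j + 1) hz with ⟨c, hc⟩ | ⟨c, hc⟩ <;>
      obtain ⟨w, rfl | rfl⟩ := Int.even_or_odd' c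
      · exact .inl ⟨w, by rw [hc]; ring⟩
      · exact .inr (.inr (.inl ⟨w, by rw [hc]; ring⟩))
      · exact .inr (.inr (.inr ⟨w - 1, by rw [eq_sub_of_add_eq hc]; ring⟩))
      · exact .inr (.inl ⟨w, by rw [eq_sub_of_add_eq hc]; ring⟩)
    · have key : ∀ r : ℤ, 2 * (4 * 2 ^ j) ∣ y - r → 2 * (4 * 2 ^ j) ∣ r * r - (0 * r + 1) →
          2 * (4 * 2 ^ j) ∣ y * y - (0 * y + 1) := fun r h1 h2 => by
        have h3 := dvd_add (h1.mul_right (y + r)) h2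
        ring_nf at h3 ⊢
        exact h3
      rintro (h1 | h1 | h1 | h1) <;> refine key _ h1 ?_
      · simp
      · exact ⟨2 * 2 ^ j - 1, by ring⟩
      · exact ⟨2 * 2 ^ j + 1, by ring⟩
      · exact ⟨8 * 2 ^ j - 2, by ring⟩
  have hcard : ({1, h - 1, h + 1, 2 * h - 1} : Finset ℕ).card = 4 := by
    rw [Finset.card_insert_of_notMem, Finset.card_insert_of_notMem, Finset.card_insert_of_notMem,
      Finset.card_singleton] <;> simp <;> omega
  rw [quadCount, hset, Set.InjOn.ncard_image, Set.ncard_coe_finset, hcard]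
  intro a ha b hb hab
  have hlt : ∀ a ∈ (({1, h - 1, h + 1, 2 * h - 1} : Finset ℕ) : Set ℕ), a < 2 ^ (j + 3) := by
    intro a ha
    simp only [Finset.coe_insert, Finset.coe_singleton, Set.mem_insert_iff,
      Set.mem_singleton_iff] at ha
    omega
  have hab' := (ZMod.natCast_eq_natCast_iff' a b _).mp hab
  rwa [Nat.mod_eq_of_lt (hlt a ha), Nat.mod_eq_of_lt (hlt b hb)] at hab'

theorem card_primeFactors_two_pow_mul {k n : ℕ} (hk : k ≠ 0) (hn : Odd n) :
    (2 ^ k * n).primeFactors.card = n.primeFactors.card + 1 := by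
  have hc : (2 ^ k).Coprime n := (Nat.coprime_two_left.mpr hn).pow_left k
  rw [hc.primeFactors_mul, Finset.card_union_of_disjoint hc.disjoint_primeFactors,
    Nat.primeFactors_prime_pow hk Nat.prime_two, Finset.card_singleton, add_comm]

theorem quadCount_one_two_pow_mul (k : ℕ) {n : ℕ} (hn : Odd n) :
    quadCount 0 1 (2 ^ k * n) = quadCount 0 1 (2 ^ k) * 2 ^ n.primeFactors.card := by
  rw [quadCount_mul _ _ ((Nat.coprime_two_left.mpr hn).pow_left k), quadCount_one_of_odd hn]

theorem quadCount_one_of_mod_four_eq_two {d : ℕ} (hd : d % 4 = 2) :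
    quadCount 0 1 d = 2 ^ (rho d - 1) := by
  obtain ⟨n, rfl⟩ : ∃ n, d = 2 ^ 1 * n := ⟨d / 2, by omega⟩
  have hn : Odd n := Nat.odd_iff.mpr (by omega)
  have h2 : quadCount 0 1 (2 ^ 1) = 1 := by
    rw [quadCount, Set.ncard_eq_toFinset_card']; decide
  rw [quadCount_one_two_pow_mul 1 hn, h2, rho, card_primeFactors_two_pow_mul one_ne_zero hn]
  simp

theorem quadCount_one_of_mod_eight_eq_four {d : ℕ} (hd : d % 8 = 4) :
    quadCount 0 1 d = 2 ^ rho d := by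
  obtain ⟨n, rfl⟩ : ∃ n, d = 2 ^ 2 * n := ⟨d / 4, by omega⟩
  have hn : Odd n := Nat.odd_iff.mpr (by omega)
  have h2 : quadCount 0 1 (2 ^ 2) = 2 := by
    rw [quadCount, Set.ncard_eq_toFinset_card']; decide
  rw [quadCount_one_two_pow_mul 2 hn, h2, rho, card_primeFactors_two_pow_mul two_ne_zero hn]
  ring

theorem quadCount_one_of_mod_eight_eq_zero {d : ℕ} (hd : d % 8 = 0) (hpos : 0 < d) :
    quadCount 0 1 d = 2 ^ (rho d + 1) := by
  obtain ⟨k, n, hn, rfl⟩ := Nat.exists_eq_two_pow_mul_odd hpos.ne'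
  obtain ⟨j, rfl⟩ : ∃ j, k = j + 3 := by
    refine ⟨k - 3, (Nat.sub_add_cancel ?_).symm⟩
    have h8 : 2 ^ 3 ∣ 2 ^ k := ((Nat.coprime_two_left.mpr hn).pow_left 3).dvd_of_dvd_mul_right
      (Nat.dvd_of_mod_eq_zero hd)
    exact (Nat.pow_dvd_pow_iff_le_right (by norm_num)).mp h8
  rw [quadCount_one_two_pow_mul _ hn, quadCount_one_two_pow, rho,
    card_primeFactors_two_pow_mul (by omega) hn]
  ring

/-- The classes `c` modulo `2 d` with `c² ≡ 1` modulo `4 d` are the classes `2 y - 1` with `y`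
idempotent modulo `d`. -/
theorem ncard_sq_modEq_one {d : ℕ} (hd : 0 < d) :
    {c : ZMod (2 * d) | ∃ x : ℤ, (x : ZMod (2 * d)) = c ∧ (4 * d : ℤ) ∣ x ^ 2 - 1}.ncard =
      2 ^ rho d := by
  rw [rho, ← quadCount_idempotent hd]
  have : NeZero d := ⟨hd.ne'⟩
  have hd0 : (d : ℤ) ≠ 0 := by positivity
  symm
  refine Set.ncard_congr (fun y _ => ((2 * (y.val : ℤ) - 1 : ℤ) : ZMod (2 * d))) ?_ ?_ ?_
  · intro y hy
    refine ⟨_, rfl, ?_⟩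
    have hy' : ((y.val : ℤ) : ZMod d) * ((y.val : ℤ) : ZMod d) =
        ((1 : ℤ) : ZMod d) * ((y.val : ℤ) : ZMod d) + ((0 : ℤ) : ZMod d) := by
      simpa using hy
    obtain ⟨k, hk⟩ := (intCast_mul_self_eq_iff 1 0 d y.val).mp hy'
    exact ⟨k, by linear_combination 4 * hk⟩
  · intro y y' _ _ h
    obtain ⟨k, hk⟩ := (ZMod.intCast_eq_intCast_iff_dvd_sub _ _ _).mp h
    push_cast at hk
    have h2 : ((y.val : ℤ) : ZMod d) = ((y'.val : ℤ) : ZMod d) :=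
      (ZMod.intCast_eq_intCast_iff_dvd_sub _ _ _).mpr ⟨k, by linarith⟩
    simpa using h2
  · rintro _ ⟨x, rfl, k, hk⟩
    obtain ⟨w, rfl⟩ : ∃ w, x = 2 * w - 1 := by
      rcases Int.even_or_odd' x with ⟨z, rfl | rfl⟩
      · exfalso
        have : 4 * (z ^ 2 - d * k) = 1 := by linear_combination hk
        omega
      · exact ⟨z + 1, by ring⟩
    refine ⟨(w : ZMod d), ?_, ?_⟩
    · exact (intCast_mul_self_eq_iff 1 0 d w).mpr ⟨k, by linarith⟩
    · have h1 : (((w : ZMod d).val : ℤ) : ZMod d) = (w : ZMod d) := by simp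
      obtain ⟨l, hl⟩ := (ZMod.intCast_eq_intCast_iff_dvd_sub _ _ _).mp h1
      exact (ZMod.intCast_eq_intCast_iff_dvd_sub _ _ _).mpr ⟨l, by push_cast; linarith⟩

end Counting

/-! ### Vectors of norm `-2` and `-2d` in `L` -/

section Vectors

variable {m d : ℕ} {r : ((Fin 2 ⊕ Fin 2) ⊕ Fin 8 × Fin m) ⊕ Fin 1 → ℤ}

theorem divisor_eq_one_or_two (hr : IsKVector (latL m d) (-2) r) :
    divisor (latL m d) r = 1 ∨ divisor (latL m d) r = 2 := by
  have h := divisor_dvd (latL m d) r r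
  rw [hr.2, dvd_neg] at h
  exact (Nat.dvd_prime Nat.prime_two).mp (by exact_mod_cast h)

theorem isKVector_stdVec_one :
    IsKVector (latL m d) (-2) (stdVec m 1 (-1) 0) ∧
      divisor (latL m d) (stdVec m 1 (-1) 0) = 1 :=
  ⟨⟨isPrimitive_stdVec isCoprime_one_left, by rw [form_stdVec]; ring⟩,
    divisor_stdVec (D := 1) (by simp)⟩

theorem exists_apply_eq_stdVec_one (hr : IsKVector (latL m d) (-2) r)
    (h1 : divisor (latL m d) r = 1) :
    ∃ g ∈ stableOrthogonalGroupPlus (latL m d), g r = stdVec m 1 (-1) 0 :=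
  exists_apply_eq_of_modEq one_pos h1 isKVector_stdVec_one.2
    (by rw [hr.2, isKVector_stdVec_one.1.2]) (by simp)

/-- For a `(-2)`-vector `2 l + x h` the norm gives `d x² = 1 + 2 (l, l)`. -/
theorem mod_four_eq_one_of_divisor_eq_two (hr : IsKVector (latL m d) (-2) r)
    (h2 : divisor (latL m d) r = 2) : d % 4 = 1 ∧ Odd (r (.inr 0)) := by
  obtain ⟨b, -, hb, -⟩ := exists_stdVec two_pos h2
  rw [hr.2] at hb
  rcases Int.even_or_odd' (r (.inr 0)) with ⟨z, hz | hz⟩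
  · exfalso
    have : 2 * (2 * b - 2 * (d * z ^ 2)) = -1 := by
      rw [hz] at hb; push_cast at hb; linarith
    omega
  · have h3 : (d : ℤ) = 4 * (b - d * (z ^ 2 + z)) + 1 := by
      rw [hz] at hb; push_cast at hb; linarith
    exact ⟨by omega, z, hz⟩

theorem isKVector_stdVec_two (hd : d % 4 = 1) :
    IsKVector (latL m d) (-2) (stdVec m 2 ((d - 1) / 4) 1) ∧
      divisor (latL m d) (stdVec m 2 ((d - 1) / 4) 1) = 2 := by
  have hb : 4 * (((d : ℤ) - 1) / 4) = d - 1 := Int.mul_ediv_cancel' (by omega)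
  exact ⟨⟨isPrimitive_stdVec isCoprime_one_right, by rw [form_stdVec]; linarith⟩,
    divisor_stdVec (D := 2) (by simp)⟩

theorem exists_apply_eq_stdVec_two (hr : IsKVector (latL m d) (-2) r)
    (h2 : divisor (latL m d) r = 2) :
    ∃ g ∈ stableOrthogonalGroupPlus (latL m d), g r = stdVec m 2 ((d - 1) / 4) 1 := by
  obtain ⟨hd, z, hz⟩ := mod_four_eq_one_of_divisor_eq_two hr h2
  refine exists_apply_eq_of_modEq two_pos h2 (isKVector_stdVec_two hd).2
    (by rw [hr.2, (isKVector_stdVec_two hd).1.2]) ⟨-z, ?_⟩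
  change 1 - _ = _
  rw [hz]
  push_cast
  ring

theorem complementIsometric_of_divisor_eq_one (hr : IsKVector (latL m d) (-2) r)
    (h1 : divisor (latL m d) r = 1) : ComplementIsometric (latL m d) r (latK m d) := by
  obtain ⟨g, hg, hgr⟩ := exists_apply_eq_stdVec_one hr h1
  have h : ComplementIsometric (latL m d) r
      (orthSum (orthSum hypU (mE8neg m)) !![-2 * -1, 0; 0, -2 * (d : ℤ)]) :=
    .of_apply hg.1.1 hgr (complementIsometric_stdVec one_ne_zero (by ring))
  exact (h.trans (equivalent_orthSum (.refl _) (equivalent_rankOne_add_rankOne _ _))).trans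
    (equivalent_orthSum_assoc _ _ _)

theorem complementIsometric_of_divisor_eq_two (hr : IsKVector (latL m d) (-2) r)
    (h2 : divisor (latL m d) r = 2) : ComplementIsometric (latL m d) r (latN m d) := by
  obtain ⟨g, hg, hgr⟩ := exists_apply_eq_stdVec_two hr h2
  have hd := (mod_four_eq_one_of_divisor_eq_two hr h2).1
  have hb : 4 * (((d : ℤ) - 1) / 4) = d - 1 := Int.mul_ediv_cancel' (by omega)
  have hb' : 2 * ((1 - (d : ℤ)) / 2) = 1 - d := Int.mul_ediv_cancel' (by omega)
  have h := ComplementIsometric.of_apply hg.1.1 hgr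
    (complementIsometric_stdVec (t := d) two_ne_zero (by ring))
  exact h.trans (equivalent_orthSum (.refl _) (equivalent_binary 2 1 1 0 (by ring)
    (by linarith) (by linarith) (by linarith)))

theorem complementIsometric_latII (hd : 0 < d) (hr : IsKVector (latL m d) (-2 * (d : ℤ)) r)
    (hdiv : divisor (latL m d) r = 2 * d) : ComplementIsometric (latL m d) r (latII m) := by
  obtain ⟨b, t, ht, hb, h⟩ := exists_complementIsometric (by omega) hdiv
  have hd0 : (2 * d : ℤ) ≠ 0 := by positivity
  rw [hr.2] at hb
  push_cast at ht hb
  have hx : r (.inr 0) = t := mul_left_cancel₀ hd0 ht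
  rw [hx] at hb
  have hdet : t ^ 2 - -2 * b * (-2 * d) = 1 := mul_left_cancel₀ hd0 (by linarith)
  have hbin := equivalent_hyperbolic_of_even 1 hdet ⟨-b, by ring⟩ ⟨-d, by ring⟩
  simp only [one_mul] at hbin
  exact (h.trans (equivalent_orthSum (.refl _) hbin)).trans (equivalent_orthSum_right_comm _ _ _)

theorem complementIsometric_latK_or_latT (hd : 0 < d)
    (hr : IsKVector (latL m d) (-2 * (d : ℤ)) r) (hdiv : divisor (latL m d) r = d) :
    ComplementIsometric (latL m d) r (latK m 1) ∨ ComplementIsometric (latL m d) r (latT m) := by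
  obtain ⟨b, t, ht, hb, h⟩ := exists_complementIsometric hd hdiv
  have hd0 : (d : ℤ) ≠ 0 := by positivity
  rw [hr.2] at hb
  have hx : t = 2 * r (.inr 0) := mul_left_cancel₀ hd0 (by linarith)
  have hdet : r (.inr 0) ^ 2 - -b * -d = 1 :=
    mul_left_cancel₀ (mul_ne_zero two_ne_zero hd0) (by linarith)
  have hmat : (!![-2 * b, t; t, -2 * (d : ℤ)] : Matrix (Fin 2) (Fin 2) ℤ) =
      !![2 * -b, 2 * r (.inr 0); 2 * r (.inr 0), 2 * -d] := by
    rw [hx, mul_neg, mul_neg, neg_mul, neg_mul]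
  rw [hmat] at h
  rcases equivalent_hyperbolic_or_diagonal 2 hdet with hbin | hbin
  · right
    have hU : (!![0, 2; 2, 0] : Matrix (Fin 2) (Fin 2) ℤ) = (2 : ℤ) • hypU := by
      rw [hypU]; decide
    rw [hU] at hbin
    exact (h.trans (equivalent_orthSum (.refl _) hbin)).trans (equivalent_orthSum_right_comm _ _ _)
  · left
    exact (h.trans (equivalent_orthSum (.refl _)
      (hbin.trans (equivalent_rankOne_add_rankOne _ _)))).trans (equivalent_orthSum_assoc _ _ _)

/-- The orbits of the stable orthogonal group on the vectors of norm `k` and divisor `D` are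
counted by the classes modulo `D` of the coordinate in the rank one summand. -/
theorem ncard_orbits_eq_ncard_classes {k : ℤ} {D : ℕ} (hD : 0 < D) :
    (orbits (stableOrthogonalGroup (latL m d))
      {r | IsKVector (latL m d) k r ∧ divisor (latL m d) r = D}).ncard =
    ((fun r : ((Fin 2 ⊕ Fin 2) ⊕ Fin 8 × Fin m) ⊕ Fin 1 → ℤ => (r (.inr 0) : ZMod D)) ''
      {r | IsKVector (latL m d) k r ∧ divisor (latL m d) r = D}).ncard := by
  refine ncard_orbits_eq_ncard_image _ fun v hv w hw => ?_
  rw [ZMod.intCast_eq_intCast_iff_dvd_sub]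
  constructor
  · intro h
    obtain ⟨g, hg, hgv⟩ := exists_apply_eq_of_modEq hD hv.2 hw.2 (by rw [hv.1.2, hw.1.2]) h
    exact ⟨g, hg.2, hgv⟩
  · rintro ⟨g, hg, rfl⟩
    obtain ⟨l, hl⟩ := exists_apply_eq_add_smul hD hg (hv.2 ▸ divisor_dvd (latL m d) v)
    exact ⟨l (.inr 0), by rw [hl]; simp⟩

theorem ncard_orbits_divisor_two_mul (hd : 0 < d) :
    (orbits (stableOrthogonalGroup (latL m d))
      {r | IsKVector (latL m d) (-2 * (d : ℤ)) r ∧ divisor (latL m d) r = 2 * d}).ncard =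
      2 ^ rho d := by
  rw [ncard_orbits_eq_ncard_classes (by omega), ← ncard_sq_modEq_one hd]
  congr 1
  have hd0 : (2 * d : ℤ) ≠ 0 := by positivity
  ext c
  constructor
  · rintro ⟨r, ⟨hr, hdiv⟩, rfl⟩
    obtain ⟨b, -, hb, -⟩ := exists_stdVec (by omega) hdiv
    rw [hr.2] at hb
    push_cast at hb
    exact ⟨r (.inr 0), rfl, b, mul_left_cancel₀ hd0 (by linarith)⟩
  · rintro ⟨x, rfl, b, hb⟩
    refine ⟨stdVec m (2 * d : ℕ) b x, ⟨⟨isPrimitive_stdVec ?_, ?_⟩, divisor_stdVec ?_⟩, rfl⟩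
    · exact ⟨-(2 * b), x, by push_cast; linarith⟩
    · rw [form_stdVec]
      push_cast
      linear_combination (-2 * d : ℤ) * hb
    · exact ⟨x, by push_cast; ring⟩

theorem ncard_orbits_divisor_self (hd : 0 < d) :
    (orbits (stableOrthogonalGroup (latL m d))
      {r | IsKVector (latL m d) (-2 * (d : ℤ)) r ∧ divisor (latL m d) r = d}).ncard =
      quadCount 0 1 d := by
  rw [ncard_orbits_eq_ncard_classes hd, quadCount]
  congr 1
  have hd0 : (2 * d : ℤ) ≠ 0 := by positivity
  ext c
  constructor
  · rintro ⟨r, ⟨hr, hdiv⟩, rfl⟩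
    obtain ⟨b, -, hb, -⟩ := exists_stdVec hd hdiv
    rw [hr.2] at hb
    exact (intCast_mul_self_eq_iff 0 1 d _).mpr ⟨b, mul_left_cancel₀ hd0 (by linarith)⟩
  · intro hc
    obtain ⟨x, rfl⟩ := ZMod.intCast_surjective c
    obtain ⟨b, hb⟩ := (intCast_mul_self_eq_iff 0 1 d _).mp hc
    refine ⟨stdVec m d b x, ⟨⟨isPrimitive_stdVec ?_, ?_⟩, divisor_stdVec ?_⟩, rfl⟩
    · exact ⟨-b, x, by linarith⟩
    · rw [form_stdVec]
      linear_combination (-2 * d : ℤ) * hb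
    · exact ⟨2 * x, by ring⟩

end Vectors

end LatticeOrbits

open LatticeOrbits in
theorem proposition2p4 (m d : ℕ) (hd : 0 < d) :
    -- (i)
    ((orbits (orthogonalGroupPlus (latII m)) {r | IsKVector (latII m) (-2) r}).ncard = 1 ∧
      ∀ r, IsKVector (latII m) (-2) r → ComplementIsometric (latII m) r (latKII m)) ∧
    -- (ii)
    ((∀ r, IsKVector (latL m d) (-2) r → divisor (latL m d) r = 1 ∨ divisor (latL m d) r = 2) ∧
      (orbits (stableOrthogonalGroupPlus (latL m d))
        {r | IsKVector (latL m d) (-2) r ∧ divisor (latL m d) r = 1}).ncard = 1 ∧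
      (d % 4 = 1 →
        (orbits (stableOrthogonalGroupPlus (latL m d))
          {r | IsKVector (latL m d) (-2) r ∧ divisor (latL m d) r = 2}).ncard = 1) ∧
      (d % 4 ≠ 1 → ∀ r, IsKVector (latL m d) (-2) r → divisor (latL m d) r ≠ 2) ∧
      (∀ r, IsKVector (latL m d) (-2) r → divisor (latL m d) r = 1 →
        ComplementIsometric (latL m d) r (latK m d)) ∧
      (∀ r, IsKVector (latL m d) (-2) r → divisor (latL m d) r = 2 →
        ComplementIsometric (latL m d) r (latN m d))) ∧
    -- (iii)
    ((∀ r, IsKVector (latL m d) (-2 * (d : ℤ)) r → divisor (latL m d) r = 2 * d →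
        ComplementIsometric (latL m d) r (latII m)) ∧
      (∀ r, IsKVector (latL m d) (-2 * (d : ℤ)) r → divisor (latL m d) r = d →
        ComplementIsometric (latL m d) r (latK m 1) ∨
          ComplementIsometric (latL m d) r (latT m))) ∧
    -- (iv)
    (1 < d →
      (orbits (stableOrthogonalGroup (latL m d))
        {r | IsKVector (latL m d) (-2 * (d : ℤ)) r ∧ divisor (latL m d) r = 2 * d}).ncard
          = 2 ^ rho d ∧
      ((Odd d ∨ d % 8 = 4) →
        (orbits (stableOrthogonalGroup (latL m d))
          {r | IsKVector (latL m d) (-2 * (d : ℤ)) r ∧ divisor (latL m d) r = d}).ncard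
            = 2 ^ rho d) ∧
      (d % 8 = 0 →
        (orbits (stableOrthogonalGroup (latL m d))
          {r | IsKVector (latL m d) (-2 * (d : ℤ)) r ∧ divisor (latL m d) r = d}).ncard
            = 2 ^ (rho d + 1)) ∧
      (d % 4 = 2 →
        (orbits (stableOrthogonalGroup (latL m d))
          {r | IsKVector (latL m d) (-2 * (d : ℤ)) r ∧ divisor (latL m d) r = d}).ncard
            = 2 ^ (rho d - 1))) := by
  refine ⟨⟨?_, fun r hr => ?_⟩, ⟨fun r => divisor_eq_one_or_two, ?_, fun hd4 => ?_,
    fun hd4 r hr h2 => hd4 (mod_four_eq_one_of_divisor_eq_two hr h2).1,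
    fun r => complementIsometric_of_divisor_eq_one, fun r => complementIsometric_of_divisor_eq_two⟩,
    ⟨fun r => complementIsometric_latII hd, fun r => complementIsometric_latK_or_latT hd⟩,
    fun _ => ⟨ncard_orbits_divisor_two_mul hd, ?_⟩⟩
  · refine ncard_orbits_eq_one isKVector_vecII fun r hr => ?_
    obtain ⟨g, hg, h⟩ := exists_apply_eq_vecII hr
    exact ⟨g, hg.1, h⟩
  · obtain ⟨g, hg, h⟩ := exists_apply_eq_vecII hr
    exact .of_apply hg.1.1 h complementIsometric_vecII
  · exact ncard_orbits_eq_one isKVector_stdVec_one fun r hr => exists_apply_eq_stdVec_one hr.1 hr.2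
  · exact ncard_orbits_eq_one (isKVector_stdVec_two hd4) fun r hr =>
      exists_apply_eq_stdVec_two hr.1 hr.2
  · rw [ncard_orbits_divisor_self hd]
    exact ⟨fun h => h.elim quadCount_one_of_odd quadCount_one_of_mod_eight_eq_four,
      fun h => quadCount_one_of_mod_eight_eq_zero h hd, quadCount_one_of_mod_four_eq_two⟩
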